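/- Conventions. All curves lie in the Euclidean plane. Let $K$ be the boundary of a convex body and $L$ a convex curve inside it. The Poncelet map sends $A\in K$ to the point $A'\in K$, $A'\ne A$, such that the line $AA'$ is tangent to $L$ (a supporting line that meets $L$) and $L$ lies on the left when the line is directed from $A$ to $A'$. For $n\ge 3$, $K,L$ is an *$n$-Poncelet pair* if for some $A\in K$ the orbit of $A$ under the Poncelet map returns to $A$ after $n$ steps and not earlier. Let $e(n)$ be Euler's totient, the number of natural numbers $m<n$ with $\gcd(m,n)=1$. A *nested family inside a convex body $B$* is a family $(D_t)_{0\le t\le1}$ of compact convex sets, continuous for the Hausdorff distance, with $D_s\subsetneq D_t$ for $s<t$, such that $D_0$ is a point, $D_t$ has interior points and a differentiable boundary curve for $0<t\le 1$, $D_t\subset\operatorname{int}B$ for $t<1$, and $D_1\subset B$ touches $\partial B$. **Theorem 1.** Let $n\ge 3$. (1) Let $K$ be a circle with centre $C$ and radius $R$, and let $o$ be a point with $|o-C|<R$. Among the circles $L$ with centre $o$ and radius $t\in(0,R-|o-C|)$ there are exactly $e(n)/2$ for which $K,L$ is an $n$-Poncelet pair. (2) More generally, let $K$ be a circle that bounds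 the closed disc $B$, and let $(D_t)_{0\le t\le 1}$ be a nested family inside $B$ of closed discs with boundary circles $L_t$ (centres may vary). Then exactly $e(n)/2$ of the circles $L_t$, $0<t<1$, form an $n$-Poncelet pair with $K$. (3) Let $K$ be the differentiable boundary curve of a strictly convex compact set $B$ with interior points, and let $(D_t)_{0\le t\le 1}$ be a nested family inside $B$ with boundary curves $L_t$. Suppose that every pair $K,L_t$, $0<t<1$, has the closure property: for every $m\ge1$, if one orbit of the Poncelet map closes after exactly $m$ steps, then every orbit does. Then exactly $e(n)/2$ of the curves $L_t$, $0<t<1$, form an $n$-Poncelet pair with $K$. -/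

import Mathlib

/-- The Euclidean plane. -/
abbrev Plane : Type := EuclideanSpace ℝ (Fin 2)

/-- The determinant of `A' - A` and `X - A`: it is `≥ 0` exactly when `X` lies on the left of, or
on, the line through `A` and `A'` directed from `A` to `A'`, and `0` exactly when `X` lies on it. -/
def orient (A A' X : Plane) : ℝ :=
  (A' 0 - A 0) * (X 1 - A 1) - (A' 1 - A 1) * (X 0 - A 0)

/-- One step `A ↦ A'` of the Poncelet map of the convex curves `K`, `L`: the points `A`, `A'` of `K`
are distinct, and the line through them is tangent to `L` (it meets `L`, and `L` is on one side),
with `L` on the left when the line is directed from `A` to `A'`. -/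
structure PonceletStep (K L : Set Plane) (A A' : Plane) : Prop where
  mem : A ∈ K
  mem' : A' ∈ K
  ne : A ≠ A'
  left : ∀ X ∈ L, 0 ≤ orient A A' X
  meets : ∃ X ∈ L, orient A A' X = 0

/-- The Poncelet polygon that starts at `A` closes after `n` steps, and not earlier. -/
def PonceletCloses (n : ℕ) (K L : Set Plane) (A : Plane) : Prop :=
  ∃ P : ℕ → Plane, P 0 = A ∧ (∀ i < n, PonceletStep K L (P i) (P (i + 1))) ∧
    P n = A ∧ ∀ k, 0 < k → k < n → P k ≠ A

/-- `K`, `L` is an `n`-Poncelet pair: some Poncelet polygon closes after exactly `n` steps. -/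
def IsPonceletPair (n : ℕ) (K L : Set Plane) : Prop :=
  ∃ A ∈ K, PonceletCloses n K L A

/-- The closure property of a pair of curves: if one Poncelet polygon closes after exactly `n`
steps, then so does the one that starts at any other point. -/
def HasPonceletClosure (K L : Set Plane) : Prop :=
  ∀ n : ℕ, 0 < n → IsPonceletPair n K L → ∀ A ∈ K, PonceletCloses n K L A

/-- `D` is a compact convex set with interior points whose boundary is a differentiable curve:
there is exactly one supporting line (one inner unit normal) at each boundary point. -/
structure IsDifferentiableConvexBody (D : Set Plane) : Prop where
  compact : IsCompact D
  convex : Convex ℝ D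
  interior_nonempty : (interior D).Nonempty
  unique_normal : ∀ P ∈ frontier D, ∃! u : Plane, ‖u‖ = 1 ∧ ∀ X ∈ D, 0 ≤ inner ℝ u (X - P)

/-- A continuous (for the Hausdorff distance) and strictly increasing family `D t`, `0 ≤ t ≤ 1`, of
convex bodies with differentiable boundary, that starts from a point (for `t = 0`), stays inside
the interior of `B` for `t < 1`, and touches the boundary of `B` from inside for `t = 1`. -/
structure IsNestedFamily (B : Set Plane) (D : ℝ → Set Plane) : Prop where
  body : ∀ t ∈ Set.Ioc (0 : ℝ) 1, IsDifferentiableConvexBody (D t)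
  start : ∃ o : Plane, D 0 = {o}
  strictMono : StrictMonoOn D (Set.Icc 0 1)
  continuous : ∀ t ∈ Set.Icc (0 : ℝ) 1,
    Filter.Tendsto (fun s => Metric.hausdorffDist (D s) (D t))
      (nhdsWithin t (Set.Icc 0 1)) (nhds 0)
  inside : ∀ t ∈ Set.Ico (0 : ℝ) 1, D t ⊆ interior B
  subset_one : D 1 ⊆ B
  touch : (D 1 ∩ frontier B).Nonempty

/-- The set `S` of curves has exactly `e(n) / 2` elements, where `e(n)`, Euler's totient, is the
number of natural numbers `m < n` that are coprime to `n`. -/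
def HasHalfTotientMany (n : ℕ) (S : Set (Set Plane)) : Prop :=
  S.Finite ∧ (S.ncard : ℚ) = (Nat.totient n : ℚ) / 2

open Set Filter Topology

/-! Parametrize $K$ counterclockwise with period 1. The Poncelet map of $K, L_t$ lifts to a strictly
increasing continuous map $T_t$ of the line with $T_t(x+1)=T_t(x)+1$ and $x<T_t(x)<x+1$. An orbit
closes after exactly $n$ steps iff $T_t^n(x)=x+m$ with $m$ coprime to $n$ (`closes_iff`), so $m/n$
is a rotation number. A larger $D_t$ gives a smaller $T_t$, and iterates at a fixed point are
continuous in $t<1$.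

At $t=0$ each chord through the point $D_0$ is run back and forth, so $T_0^2(x)=x+1$ and the
rotation number is $1/2$. If $D_1$ touches $K$ at parameter $x$, differentiability of $D_1$ forces
$T_t^k(x)\to x$ as $t\to1$ (`exists_iterate_lt`). Hence only $0<m<n/2$ can occur, and the
intermediate value theorem realizes each such $m$ (`exists_iterate_eq`).

The parameter $t$ is unique for given $m$: the closure property makes $T_t^n$ the translation by $m$
everywhere, two comparable lifts with this property coincide, and the lift determines the convex set
through its supporting lines (`eq_of_iterate_eq`). The involution $m\mapsto n-m$ shows that the
admissible $m$ number $e(n)/2$.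

For circles the closure property is Poncelet's theorem. The density $1/\ell$, with $\ell$ the length
of the tangents from a point of $K$ to $L$, is invariant; its integral is a coordinate in which the
Poncelet map is a translation (`exists_conjugation`). -/

/-! ### The orientation determinant. -/

theorem orient_swap (A B X : Plane) : orient B A X = -orient A B X := by
  simp only [orient]; ring

theorem orient_rotate (A B X : Plane) : orient A B X = orient B X A := by
  simp only [orient]; ring

theorem orient_lineMap (A B P Q : Plane) (r : ℝ) :
    orient A B (P + r • (Q - P)) = (1 - r) * orient A B P + r * orient A B Q := by
  simp only [orient, PiLp.add_apply, PiLp.smul_apply, PiLp.sub_apply, smul_eq_mul]; ring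

@[simp] theorem orient_self_left (A B : Plane) : orient A B A = 0 := by
  simp only [orient]; ring

@[simp] theorem orient_self_right (A B : Plane) : orient A B B = 0 := by
  simp only [orient]; ring

theorem continuous_orient : Continuous fun p : Plane × Plane × Plane => orient p.1 p.2.1 p.2.2 := by
  unfold orient; fun_prop

theorem Continuous.orient {α : Type*} [TopologicalSpace α] {f g h : α → Plane} (hf : Continuous f)
    (hg : Continuous g) (hh : Continuous h) : Continuous fun a => orient (f a) (g a) (h a) :=
  continuous_orient.comp (hf.prodMk (hg.prodMk hh))

/-- From an interior point of a compact set, every ray reaches the boundary. -/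
theorem exists_add_smul_mem_frontier {B : Set Plane} (hB : IsCompact B) {X v : Plane}
    (hX : X ∈ interior B) (hv : v ≠ 0) : ∃ s : ℝ, 0 < s ∧ X + s • v ∈ frontier B := by
  have hconn : IsPreconnected ((fun s : ℝ => X + s • v) '' Ici 0) :=
    isPreconnected_Ici.image _ (by fun_prop)
  obtain ⟨M, hM⟩ := hB.isBounded.subset_closedBall X
  have hv' : 0 < ‖v‖ := norm_pos_iff.2 hv
  have hM0 : 0 ≤ M := by simpa using hM (interior_subset hX)
  obtain ⟨s, hs, hfr⟩ : ∃ s ∈ Ici (0 : ℝ), X + s • v ∈ frontier B := by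
    by_contra! hno
    obtain ⟨Y, -, hY, hY'⟩ := hconn (interior B) Bᶜ isOpen_interior hB.isClosed.isOpen_compl
      (by
        rintro _ ⟨s, hs, rfl⟩
        by_cases hB' : X + s • v ∈ B
        · exact Or.inl (by_contra fun hi => hno s hs ⟨subset_closure hB', hi⟩)
        · exact Or.inr hB')
      ⟨X, ⟨0, by simp, by simp⟩, hX⟩
      (by
        refine ⟨_, ⟨(M + 1) / ‖v‖, by simp only [mem_Ici]; positivity, rfl⟩, fun h => ?_⟩
        have := hM h
        rw [mem_closedBall_iff_norm, add_sub_cancel_left, norm_smul, Real.norm_of_nonneg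
          (by positivity), div_mul_cancel₀ _ hv'.ne'] at this
        linarith)
    exact hY' (interior_subset hY)
  refine ⟨s, lt_of_le_of_ne hs ?_, hfr⟩
  rintro rfl
  simp only [zero_smul, add_zero] at hfr
  exact hfr.2 hX

/-! ### Convex parametrizations and the lift of the Poncelet map. -/

/-- `γ` runs once, counterclockwise, through the boundary of the compact set `B` as its parameter
runs through an interval of length `1`, and no three points of that boundary are collinear. -/
structure IsConvexParam (B : Set Plane) (γ : ℝ → Plane) : Prop where
  compact : IsCompact B
  continuous : Continuous γ
  periodic : Function.Periodic γ 1
  range_eq : range γ = frontier B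
  orient_pos : ∀ a b c, a < b → b < c → c < a + 1 → 0 < orient (γ a) (γ b) (γ c)

/-- The parameter, in `(x, x + 1)`, of the second endpoint of the chord from `γ x` through `X`. -/
noncomputable def secondEnd (γ : ℝ → Plane) (X : Plane) (x : ℝ) : ℝ :=
  Classical.epsilon fun y => y ∈ Ioo x (x + 1) ∧ ∃ r ∈ Ioo (0 : ℝ) 1, X = γ x + r • (γ y - γ x)

/-- The lift to the line of the Poncelet map of the curve `γ` and the set `L`. -/
noncomputable def ponceletLift (γ : ℝ → Plane) (L : Set Plane) (x : ℝ) : ℝ :=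
  sInf ((fun X => secondEnd γ X x) '' L)

namespace IsConvexParam

variable {B L : Set Plane} {γ : ℝ → Plane} {X : Plane} {x y : ℝ}

theorem mem_frontier (h : IsConvexParam B γ) (x : ℝ) : γ x ∈ frontier B :=
  h.range_eq ▸ mem_range_self x

theorem ne_of_mem_Ioo (h : IsConvexParam B γ) (hy : y ∈ Ioo x (x + 1)) : γ x ≠ γ y := by
  intro he
  have := h.orient_pos x y ((y + (x + 1)) / 2) hy.1 (by linarith [hy.2]) (by linarith [hy.2])
  rw [he] at this
  simp [_root_.orient] at this

theorem exists_mem_Ico (h : IsConvexParam B γ) {P : Plane} (hP : P ∈ frontier B) (x : ℝ) :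
    ∃ y ∈ Ico x (x + 1), γ y = P := by
  obtain ⟨z, rfl⟩ := h.range_eq ▸ hP
  obtain ⟨y, hy, hyz⟩ := h.periodic.exists_mem_Ico one_pos z x
  exact ⟨y, hy, hyz.symm⟩

theorem map_add_int (h : IsConvexParam B γ) (x : ℝ) (m : ℤ) : γ (x + m) = γ x := by
  simpa using h.periodic.int_mul m x

theorem eq_iff (h : IsConvexParam B γ) : γ y = γ x ↔ ∃ m : ℤ, y = x + m := by
  constructor
  · intro he
    by_contra hm
    push Not at hm
    have hfl := hm ⌊y - x⌋
    refine h.ne_of_mem_Ioo (x := x) (y := y - ⌊y - x⌋) ⟨?_, ?_⟩ ?_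
    · exact lt_of_le_of_ne (by linarith [Int.floor_le (y - x)]) fun e => hfl (by linarith)
    · linarith [Int.lt_floor_add_one (y - x)]
    · rw [← h.map_add_int (y - _) ⌊y - x⌋, sub_add_cancel, he]
  · rintro ⟨m, rfl⟩
    exact h.map_add_int x m

theorem exists_chord (h : IsConvexParam B γ) (hX : X ∈ interior B) (x : ℝ) :
    ∃ y, y ∈ Ioo x (x + 1) ∧ ∃ r ∈ Ioo (0 : ℝ) 1, X = γ x + r • (γ y - γ x) := by
  have hne : X - γ x ≠ 0 := by
    rw [sub_ne_zero]
    rintro rfl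
    exact (h.mem_frontier x).2 hX
  obtain ⟨s, hs, hfr⟩ := exists_add_smul_mem_frontier h.compact hX hne
  obtain ⟨y, hy, hyX⟩ := h.exists_mem_Ico hfr x
  have hs' : (1 + s) ≠ 0 := by positivity
  have hX' : X = γ x + (1 + s)⁻¹ • (γ y - γ x) := by
    have : γ y - γ x = (1 + s) • (X - γ x) := by rw [hyX]; module
    rw [this, inv_smul_smul₀ hs']; abel
  refine ⟨y, ⟨lt_of_le_of_ne hy.1 ?_, hy.2⟩, (1 + s)⁻¹, ⟨by positivity, ?_⟩, hX'⟩
  · rintro rfl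
    rw [sub_self, smul_zero, add_zero] at hX'
    exact hne (sub_eq_zero.2 hX')
  · exact inv_lt_one_of_one_lt₀ (by linarith)

theorem secondEnd_spec (h : IsConvexParam B γ) (hX : X ∈ interior B) (x : ℝ) :
    secondEnd γ X x ∈ Ioo x (x + 1) ∧
      ∃ r ∈ Ioo (0 : ℝ) 1, X = γ x + r • (γ (secondEnd γ X x) - γ x) :=
  Classical.epsilon_spec (h.exists_chord hX x)

/-- `X` divides the chord that starts at `γ x`, where the affine function `orient (γ x) (γ y)`
vanishes. So its sign at `X` is its sign at the other end of the chord, which the cyclic order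
decides. -/
theorem orient_pos_of_lt_secondEnd (h : IsConvexParam B γ) (hX : X ∈ interior B) (hxy : x < y)
    (hy : y < secondEnd γ X x) : 0 < orient (γ x) (γ y) X := by
  obtain ⟨hz, r, hr, hXr⟩ := h.secondEnd_spec hX x
  have := h.orient_pos x y _ hxy hy hz.2
  rw [hXr, orient_lineMap, orient_self_left, mul_zero, zero_add]
  exact mul_pos hr.1 this

theorem orient_neg_of_secondEnd_lt (h : IsConvexParam B γ) (hX : X ∈ interior B)
    (hy : secondEnd γ X x < y) (hyx : y < x + 1) : orient (γ x) (γ y) X < 0 := by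
  obtain ⟨hz, r, hr, hXr⟩ := h.secondEnd_spec hX x
  have := h.orient_pos x _ y hz.1 hy hyx
  rw [hXr, orient_lineMap, orient_self_left, mul_zero, zero_add, orient_rotate, orient_rotate,
    orient_swap]
  nlinarith [mul_pos hr.1 this]

theorem orient_secondEnd (h : IsConvexParam B γ) (hX : X ∈ interior B) (x : ℝ) :
    orient (γ x) (γ (secondEnd γ X x)) X = 0 := by
  obtain ⟨hz, r, hr, hXr⟩ := h.secondEnd_spec hX x
  generalize secondEnd γ X x = z at hXr
  rw [hXr, orient_lineMap]; simp

theorem orient_pos_iff (h : IsConvexParam B γ) (hX : X ∈ interior B) (hy : y ∈ Ioo x (x + 1)) :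
    0 < orient (γ x) (γ y) X ↔ y < secondEnd γ X x := by
  refine ⟨fun ho => ?_, h.orient_pos_of_lt_secondEnd hX hy.1⟩
  by_contra! hle
  rcases hle.lt_or_eq with hlt | rfl
  · exact lt_asymm ho (h.orient_neg_of_secondEnd_lt hX hlt hy.2)
  · exact ho.ne' (h.orient_secondEnd hX x)

theorem orient_neg_iff (h : IsConvexParam B γ) (hX : X ∈ interior B) (hy : y ∈ Ioo x (x + 1)) :
    orient (γ x) (γ y) X < 0 ↔ secondEnd γ X x < y := by
  refine ⟨fun ho => ?_, fun hlt => h.orient_neg_of_secondEnd_lt hX hlt hy.2⟩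
  by_contra! hle
  rcases hle.lt_or_eq with hlt | rfl
  · exact lt_asymm ho (h.orient_pos_of_lt_secondEnd hX hy.1 hlt)
  · exact ho.ne (h.orient_secondEnd hX x)

theorem orient_eq_zero_iff (h : IsConvexParam B γ) (hX : X ∈ interior B)
    (hy : y ∈ Ioo x (x + 1)) : orient (γ x) (γ y) X = 0 ↔ secondEnd γ X x = y := by
  have h1 := h.orient_pos_iff hX hy
  have h2 := h.orient_neg_iff hX hy
  constructor
  · intro h0
    rw [h0, lt_self_iff_false, false_iff, not_lt] at h1 h2
    exact le_antisymm h1 h2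
  · rintro rfl
    exact h.orient_secondEnd hX x

theorem secondEnd_strictMono (h : IsConvexParam B γ) (hX : X ∈ interior B) :
    StrictMono (secondEnd γ X) := by
  intro x x' hxx
  obtain ⟨hz, r, hr, hXr⟩ := h.secondEnd_spec hX x
  rcases lt_or_ge x' (secondEnd γ X x) with hlt | hge
  · rw [← h.orient_pos_iff hX ⟨hlt, by linarith [hz.2]⟩]
    have := h.orient_pos x x' _ hxx hlt hz.2
    generalize secondEnd γ X x = z at *
    rw [hXr, orient_lineMap, orient_self_right, mul_zero, add_zero, ← orient_rotate]
    exact mul_pos (by linarith [hr.2]) this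
  · exact hge.trans_lt (h.secondEnd_spec hX x').1.1

/-- The same chord is traversed back; this is what gives a point the rotation number $1/2$. -/
theorem secondEnd_secondEnd (h : IsConvexParam B γ) (hX : X ∈ interior B) (x : ℝ) :
    secondEnd γ X (secondEnd γ X x) = x + 1 := by
  have hz := (h.secondEnd_spec hX x).1
  rw [← h.orient_eq_zero_iff hX ⟨hz.2, by linarith [hz.1]⟩, h.periodic, orient_swap,
    h.orient_secondEnd hX x, neg_zero]

theorem secondEnd_add_one (h : IsConvexParam B γ) (hX : X ∈ interior B) (x : ℝ) :
    secondEnd γ X (x + 1) = secondEnd γ X x + 1 := by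
  have hz := (h.secondEnd_spec hX x).1
  rw [← h.orient_eq_zero_iff hX ⟨by linarith [hz.1], by linarith [hz.2]⟩, h.periodic, h.periodic,
    h.orient_secondEnd hX x]

/-- Comparing `secondEnd` with a fixed `y` is a strict inequality for a continuous determinant,
hence an open condition on the pair. -/
theorem continuousOn_secondEnd (h : IsConvexParam B γ) :
    ContinuousOn (fun p : Plane × ℝ => secondEnd γ p.1 p.2) (interior B ×ˢ univ) := by
  have hint : ∀ p ∈ interior B ×ˢ (univ : Set ℝ), ∀ᶠ q in 𝓝 p, q.1 ∈ interior B := fun p hp =>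
    continuous_fst.continuousAt (isOpen_interior.mem_nhds hp.1)
  have hor : ∀ y, Continuous fun q : Plane × ℝ => orient (γ q.2) (γ y) q.1 := fun y =>
    Continuous.orient (h.continuous.comp continuous_snd) continuous_const continuous_fst
  intro p hp
  refine ContinuousAt.continuousWithinAt (tendsto_order.2 ⟨fun a ha => ?_, fun a ha => ?_⟩)
  · have hz := (h.secondEnd_spec hp.1 p.2).1
    obtain ⟨y, hy1, hy2⟩ := exists_between (max_lt ha hz.1)
    have hy3 := (le_max_right _ _).trans_lt hy1
    filter_upwards [hint p hp, (hor y).continuousAt.eventually (lt_mem_nhds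
      (h.orient_pos_of_lt_secondEnd hp.1 hy3 hy2)),
      continuous_snd.continuousAt.eventually (gt_mem_nhds hy3),
      (continuous_snd.add continuous_const).continuousAt.eventually
        (lt_mem_nhds (hy2.trans hz.2))] with q hq1 hq2 hq3 hq4
    exact ((le_max_left _ _).trans_lt hy1).trans ((h.orient_pos_iff hq1 ⟨hq3, hq4⟩).1 hq2)
  · have hz := (h.secondEnd_spec hp.1 p.2).1
    obtain ⟨y, hy1, hy2⟩ := exists_between (lt_min ha hz.2)
    have hy3 := hy2.trans_le (min_le_right _ _)
    filter_upwards [hint p hp, (hor y).continuousAt.eventually (gt_mem_nhds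
      (h.orient_neg_of_secondEnd_lt hp.1 hy1 hy3)),
      continuous_snd.continuousAt.eventually (gt_mem_nhds (hz.1.trans hy1)),
      (continuous_snd.add continuous_const).continuousAt.eventually
        (lt_mem_nhds hy3)] with q hq1 hq2 hq3 hq4
    exact ((h.orient_neg_iff hq1 ⟨hq3, hq4⟩).1 hq2).trans (hy2.trans_le (min_le_left _ _))

theorem continuousOn_secondEnd_left (h : IsConvexParam B γ) (x : ℝ) :
    ContinuousOn (fun X => secondEnd γ X x) (interior B) :=
  h.continuousOn_secondEnd.comp (f := fun X => (X, x)) (by fun_prop) fun _ hX => ⟨hX, mem_univ _⟩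

theorem isCompact_secondEnd (h : IsConvexParam B γ) (hL : IsCompact L) (hLB : L ⊆ interior B)
    (x : ℝ) : IsCompact ((fun X => secondEnd γ X x) '' L) :=
  hL.image_of_continuousOn ((h.continuousOn_secondEnd_left x).mono hLB)

theorem exists_ponceletLift_eq (h : IsConvexParam B γ) (hL : IsCompact L) (hLB : L ⊆ interior B)
    (hne : L.Nonempty) (x : ℝ) : ∃ X ∈ L, secondEnd γ X x = ponceletLift γ L x :=
  (h.isCompact_secondEnd hL hLB x).sInf_mem (hne.image _)

theorem ponceletLift_le (h : IsConvexParam B γ) (hL : IsCompact L) (hLB : L ⊆ interior B)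
    (hX : X ∈ L) (x : ℝ) : ponceletLift γ L x ≤ secondEnd γ X x :=
  csInf_le (h.isCompact_secondEnd hL hLB x).bddBelow (mem_image_of_mem _ hX)

theorem ponceletLift_mem_Ioo (h : IsConvexParam B γ) (hL : IsCompact L) (hLB : L ⊆ interior B)
    (hne : L.Nonempty) (x : ℝ) : ponceletLift γ L x ∈ Ioo x (x + 1) := by
  obtain ⟨X, hX, he⟩ := h.exists_ponceletLift_eq hL hLB hne x
  exact he ▸ (h.secondEnd_spec (hLB hX) x).1

theorem ponceletLift_strictMono (h : IsConvexParam B γ) (hL : IsCompact L)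
    (hLB : L ⊆ interior B) (hne : L.Nonempty) : StrictMono (ponceletLift γ L) := by
  intro x x' hxx
  obtain ⟨X, hX, he⟩ := h.exists_ponceletLift_eq hL hLB hne x'
  exact he ▸ (h.ponceletLift_le hL hLB hX x).trans_lt (h.secondEnd_strictMono (hLB hX) hxx)

theorem ponceletLift_add_one (h : IsConvexParam B γ) (hL : IsCompact L)
    (hLB : L ⊆ interior B) (hne : L.Nonempty) (x : ℝ) :
    ponceletLift γ L (x + 1) = ponceletLift γ L x + 1 := by
  apply le_antisymm
  · obtain ⟨X, hX, he⟩ := h.exists_ponceletLift_eq hL hLB hne x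
    rw [← he, ← h.secondEnd_add_one (hLB hX)]
    exact h.ponceletLift_le hL hLB hX _
  · obtain ⟨X, hX, he⟩ := h.exists_ponceletLift_eq hL hLB hne (x + 1)
    rw [← he, h.secondEnd_add_one (hLB hX)]
    linarith [h.ponceletLift_le hL hLB hX x]

theorem continuous_ponceletLift (h : IsConvexParam B γ) (hL : IsCompact L)
    (hLB : L ⊆ interior B) : Continuous (ponceletLift γ L) := by
  have := isCompact_iff_compactSpace.1 hL
  have key := (isCompact_univ (X := L)).continuous_sInf
    (f := fun (x : ℝ) (X : L) => secondEnd γ X x)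
    (h.continuousOn_secondEnd.comp_continuous (f := fun p : ℝ × L => ((p.2 : Plane), p.1))
      (by fun_prop) fun p => ⟨hLB p.2.2, mem_univ _⟩)
  convert key using 2 with x
  simp only [ponceletLift]
  congr 1
  ext z
  simp

/-- `L` is on the left of the chord iff `y` is a lower bound of the second endpoints, and `L` meets
the chord iff this bound is attained; hence the infimum in `ponceletLift`. -/
theorem ponceletStep_iff (h : IsConvexParam B γ) (hL : IsCompact L) (hLB : L ⊆ interior B)
    (hne : L.Nonempty) (hy : y ∈ Ioo x (x + 1)) :
    PonceletStep (frontier B) L (γ x) (γ y) ↔ y = ponceletLift γ L x := by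
  have hnn : ∀ X ∈ L, (0 ≤ orient (γ x) (γ y) X ↔ y ≤ secondEnd γ X x) := fun X hX => by
    rw [← not_lt, ← not_lt, h.orient_neg_iff (hLB hX) hy]
  constructor
  · intro hs
    obtain ⟨X, hX, hX0⟩ := hs.meets
    rw [h.orient_eq_zero_iff (hLB hX) hy] at hX0
    refine le_antisymm ?_ (hX0 ▸ h.ponceletLift_le hL hLB hX x)
    obtain ⟨Y, hY, he⟩ := h.exists_ponceletLift_eq hL hLB hne x
    exact he ▸ (hnn Y hY).1 (hs.left Y hY)
  · intro he
    obtain ⟨Y, hY, hY'⟩ := h.exists_ponceletLift_eq hL hLB hne x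
    exact ⟨h.mem_frontier x, h.mem_frontier y, h.ne_of_mem_Ioo hy,
      fun X hX => (hnn X hX).2 (he ▸ h.ponceletLift_le hL hLB hX x),
      Y, hY, (h.orient_eq_zero_iff (hLB hY) hy).2 (hY'.trans he.symm)⟩

theorem ponceletStep_iff' (h : IsConvexParam B γ) (hL : IsCompact L) (hLB : L ⊆ interior B)
    (hne : L.Nonempty) (x : ℝ) (P : Plane) :
    PonceletStep (frontier B) L (γ x) P ↔ P = γ (ponceletLift γ L x) := by
  constructor
  · intro hs
    obtain ⟨y, hy, rfl⟩ := h.exists_mem_Ico hs.mem' x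
    have hy' : y ∈ Ioo x (x + 1) :=
      ⟨lt_of_le_of_ne hy.1 fun e => hs.ne (congrArg γ e), hy.2⟩
    rw [(h.ponceletStep_iff hL hLB hne hy').1 hs]
  · rintro rfl
    exact (h.ponceletStep_iff hL hLB hne (h.ponceletLift_mem_Ioo hL hLB hne x)).2 rfl

/-- The Poncelet lift as a degree one lift of a circle map. -/
theorem exists_circleDeg1Lift (h : IsConvexParam B γ) (hL : IsCompact L)
    (hLB : L ⊆ interior B) (hne : L.Nonempty) :
    ∃ f : CircleDeg1Lift, ⇑f = ponceletLift γ L :=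
  ⟨⟨⟨ponceletLift γ L, (h.ponceletLift_strictMono hL hLB hne).monotone⟩,
    h.ponceletLift_add_one hL hLB hne⟩, rfl⟩

theorem ponceletCloses_iff (h : IsConvexParam B γ) (hL : IsCompact L) (hLB : L ⊆ interior B)
    (hne : L.Nonempty) (x : ℝ) (n : ℕ) :
    PonceletCloses n (frontier B) L (γ x) ↔
      (∃ m : ℤ, (ponceletLift γ L)^[n] x = x + m) ∧
        ∀ k, 0 < k → k < n → ¬∃ m : ℤ, (ponceletLift γ L)^[k] x = x + m := by
  constructor
  · rintro ⟨P, hP0, hstep, hPn, hk⟩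
    have hP : ∀ k ≤ n, P k = γ ((ponceletLift γ L)^[k] x) := by
      intro k
      induction k with
      | zero => intro _; simpa using hP0
      | succ k ih =>
        intro hkn
        have := hstep k (by omega)
        rw [ih (by omega), h.ponceletStep_iff' hL hLB hne] at this
        rw [this, Function.iterate_succ_apply']
    refine ⟨h.eq_iff.1 (hP n le_rfl ▸ hPn), fun k h0 hkn hm => hk k h0 hkn ?_⟩
    rw [hP k hkn.le]
    exact h.eq_iff.2 hm
  · rintro ⟨hn, hk⟩
    refine ⟨fun k => γ ((ponceletLift γ L)^[k] x), rfl, fun i _ => ?_, h.eq_iff.2 hn,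
      fun k h0 hkn e => hk k h0 hkn (h.eq_iff.1 e)⟩
    rw [h.ponceletStep_iff' hL hLB hne]
    exact congrArg γ (Function.iterate_succ_apply' _ _ _)

theorem isPonceletPair_iff (h : IsConvexParam B γ) {n : ℕ} :
    IsPonceletPair n (frontier B) L ↔ ∃ x, PonceletCloses n (frontier B) L (γ x) := by
  constructor
  · rintro ⟨A, hA, hc⟩
    obtain ⟨x, rfl⟩ := h.range_eq ▸ hA
    exact ⟨x, hc⟩
  · rintro ⟨x, hc⟩
    exact ⟨γ x, h.mem_frontier x, hc⟩

end IsConvexParam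

/-! ### Iterates of lifts of circle maps -/

namespace CircleDeg1Lift

variable (f : CircleDeg1Lift)

/-- With $d=\gcd(m,n)$, the map $f^{n/d}$ is monotone and commutes with integer translations, so its
$d$-th iterate moves `x` by $d\cdot(m/d)$ only if the map itself moves `x` by $m/d$. Thus $d>1$
would be an earlier return. -/
theorem gcd_eq_one_of_first_return {x : ℝ} {n : ℕ} {m : ℤ} (hn : 0 < n)
    (hm : f^[n] x = x + m) (hk : ∀ k, 0 < k → k < n → ¬∃ j : ℤ, f^[k] x = x + j) :
    Int.gcd m n = 1 := by
  have hd : 0 < Int.gcd m n := Int.gcd_pos_of_ne_zero_right _ (by omega)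
  obtain ⟨m', hm'⟩ := Int.gcd_dvd_left m n
  obtain ⟨n', hn'⟩ : Int.gcd m n ∣ n := Int.natCast_dvd_natCast.1 (Int.gcd_dvd_right m n)
  generalize Int.gcd m n = d at *
  have hn'0 : 0 < n' := Nat.pos_of_ne_zero fun h => by simp [h] at hn'; omega
  by_contra hd1
  refine hk n' hn'0 (by rw [hn']; exact lt_mul_of_one_lt_left hn'0 (by omega)) ⟨m', ?_⟩
  rw [← coe_pow, ← (f ^ n').iterate_pos_eq_iff hd, coe_pow, ← Function.iterate_mul, mul_comm n',
    ← hn', hm, hm']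
  push_cast; rfl

/-- Computing $f^{kn}(x)$ in two ways gives $nj=km$, so $n\mid k$. -/
theorem not_exists_return_of_gcd_eq_one {x : ℝ} {n : ℕ} {m : ℤ}
    (hm : f^[n] x = x + m) (hg : Int.gcd m n = 1) {k : ℕ} (hk0 : 0 < k) (hkn : k < n) :
    ¬∃ j : ℤ, f^[k] x = x + j := by
  rintro ⟨j, hj⟩
  have h1 := (f ^ k).iterate_eq_of_map_eq_add_int (by rwa [coe_pow]) n
  have h2 := (f ^ n).iterate_eq_of_map_eq_add_int (by rwa [coe_pow]) k
  rw [coe_pow, ← Function.iterate_mul] at h1 h2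
  rw [mul_comm n k, h1] at h2
  have h3 : (n : ℤ) * j = k * m := by exact_mod_cast add_left_cancel h2
  have h4 : (n : ℤ) ∣ k := by
    refine Int.dvd_of_dvd_mul_left_of_gcd_one (b := k) (c := m) ?_ ?_
    · exact ⟨j, by rw [h3]⟩
    · rwa [Int.gcd_comm]
  have := Nat.le_of_dvd hk0 (Int.natCast_dvd_natCast.1 h4)
  omega

/-- Two lifts, one below the other, that have the same rational rotation number and whose
iterates are translations, coincide. -/
theorem eq_of_le_of_iterate_eq {f g : CircleDeg1Lift} (hf : StrictMono f) (hfg : ∀ x, f x ≤ g x)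
    {n : ℕ} (hn : 0 < n) {m : ℤ} (hfm : ∀ x, f^[n] x = x + m) (hgm : ∀ x, g^[n] x = x + m)
    (x : ℝ) : f x = g x := by
  refine (hfg x).eq_of_not_lt fun hlt => ?_
  obtain ⟨k, rfl⟩ := Nat.exists_eq_succ_of_ne_zero hn.ne'
  -- If $f(x)<g(x)$ and $n=k+1$, then $x+m=f^k(f(x))<f^k(g(x))\le g^k(g(x))=x+m$.
  have h1 := hf.iterate k hlt
  have h2 := f.monotone.iterate_le_of_le hfg k (g x)
  rw [← Function.iterate_succ_apply, hfm] at h1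
  rw [← Function.iterate_succ_apply g, hgm] at h2
  exact absurd (h1.trans_le h2) (lt_irrefl _)

end CircleDeg1Lift

/-- Joint continuity is not needed: monotonicity in the space variable lets a nearby fixed point `z`
replace the moving iterate, so separate continuity suffices. -/
theorem continuousOn_iterate {S : Set ℝ} {T : ℝ → ℝ → ℝ} (hmono : ∀ t ∈ S, Monotone (T t))
    (hcont : ∀ t ∈ S, Continuous (T t)) (hT : ∀ x, ContinuousOn (fun t => T t x) S) (x : ℝ)
    (k : ℕ) : ContinuousOn (fun t => (T t)^[k] x) S := by
  induction k with
  | zero => simpa using continuousOn_const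
  | succ k ih =>
    intro t ht
    simp only [Function.iterate_succ_apply', ContinuousWithinAt]
    set y := (T t)^[k] x with hy
    have hev : ∀ᶠ s in 𝓝[S] t, s ∈ S := self_mem_nhdsWithin
    refine tendsto_order.2 ⟨fun a ha => ?_, fun a ha => ?_⟩
    · obtain ⟨z, hz, hzy⟩ := (((hcont t ht).continuousAt.eventually (lt_mem_nhds ha)).filter_mono
        nhdsWithin_le_nhds |>.and (self_mem_nhdsWithin (s := Iio y))).exists
      filter_upwards [hev, (hT z t ht).eventually (lt_mem_nhds hz),
        (ih t ht).eventually (lt_mem_nhds (show z < (T t)^[k] x from hzy))] with s hs h1 h2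
      exact h1.trans_le (hmono s hs h2.le)
    · obtain ⟨z, hz, hzy⟩ := (((hcont t ht).continuousAt.eventually (gt_mem_nhds ha)).filter_mono
        nhdsWithin_le_nhds |>.and (self_mem_nhdsWithin (s := Ioi y))).exists
      filter_upwards [hev, (hT z t ht).eventually (gt_mem_nhds hz),
        (ih t ht).eventually (gt_mem_nhds (show (T t)^[k] x < z from hzy))] with s hs h1 h2
      exact (hmono s hs h2.le).trans_lt h1

/-! ### Dependence of the Poncelet map on the inner set -/

theorem exists_apply_eq_coords (f : StrongDual ℝ Plane) :
    ∃ p q : ℝ, ∀ Z : Plane, f Z = p * Z 0 + q * Z 1 := by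
  set w := (InnerProductSpace.toDual ℝ Plane).symm f
  refine ⟨w 0, w 1, fun Z => ?_⟩
  rw [← InnerProductSpace.toDual_symm_apply, PiLp.inner_apply, Fin.sum_univ_two]
  simp [w, mul_comm]

namespace IsConvexParam

variable {B D E : Set Plane} {γ : ℝ → Plane}

theorem ponceletLift_anti (h : IsConvexParam B γ) (hE : IsCompact E)
    (hEB : E ⊆ interior B) (hD : IsCompact D) (hne : D.Nonempty) (hDE : D ⊆ E) (x : ℝ) :
    ponceletLift γ E x ≤ ponceletLift γ D x := by
  obtain ⟨X, hX, he⟩ := h.exists_ponceletLift_eq hD (hDE.trans hEB) hne x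
  exact he ▸ h.ponceletLift_le hE hEB (hDE hX) x

theorem exists_mem_frontier_ponceletLift_eq (h : IsConvexParam B γ) (hD : IsCompact D)
    (hDB : D ⊆ interior B) (hne : D.Nonempty) (x : ℝ) :
    ∃ X ∈ frontier D, secondEnd γ X x = ponceletLift γ D x := by
  obtain ⟨X, hX, he⟩ := h.exists_ponceletLift_eq hD hDB hne x
  refine ⟨X, ⟨subset_closure hX, fun hi => ?_⟩, he⟩
  have hy := (h.secondEnd_spec (hDB hX) x).1
  set y := secondEnd γ X x with hy'
  -- A point of the arc to the right of the chord. Moving an interior minimizer towards it would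
  -- lower the second endpoint.
  have hQ := h.orient_pos x ((x + y) / 2) y (by linarith [hy.1]) (by linarith [hy.1]) hy.2
  rw [orient_rotate, orient_rotate, orient_swap] at hQ
  set Q := γ ((x + y) / 2)
  have hc : Continuous fun r : ℝ => X + r • (Q - X) := by fun_prop
  obtain ⟨r, hr, hr0⟩ := ((hc.continuousAt (x := 0)).eventually
    (isOpen_interior.mem_nhds (by simpa using hi)) |>.filter_mono nhdsWithin_le_nhds |>.and
    (self_mem_nhdsWithin (s := Ioi (0 : ℝ)))).exists
  have hrD := interior_subset hr
  have ho : orient (γ x) (γ y) (X + r • (Q - X)) < 0 := by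
    rw [orient_lineMap, h.orient_secondEnd (hDB hX) x]
    nlinarith
  have := (h.orient_neg_iff (hDB hrD) hy).1 ho
  linarith [h.ponceletLift_le hD hDB hrD x]

theorem frontier_nonempty (h : IsConvexParam B γ) (hD : IsCompact D)
    (hDB : D ⊆ interior B) (hne : D.Nonempty) : (frontier D).Nonempty :=
  let ⟨X, hX, _⟩ := h.exists_mem_frontier_ponceletLift_eq hD hDB hne 0
  ⟨X, hX⟩

theorem ponceletLift_frontier (h : IsConvexParam B γ) (hD : IsCompact D)
    (hDB : D ⊆ interior B) (hne : D.Nonempty) :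
    ponceletLift γ (frontier D) = ponceletLift γ D := by
  have hfD : IsCompact (frontier D) := hD.of_isClosed_subset isClosed_frontier
    hD.isClosed.frontier_subset
  ext x
  obtain ⟨X, hX, he⟩ := h.exists_mem_frontier_ponceletLift_eq hD hDB hne x
  exact le_antisymm (he ▸ h.ponceletLift_le hfD (hD.isClosed.frontier_subset.trans hDB) hX x)
    (h.ponceletLift_anti hD hDB hfD ⟨X, hX⟩ hD.isClosed.frontier_subset x)

/-- The Poncelet map determines the inner convex set. -/
theorem eq_of_ponceletLift_eq (h : IsConvexParam B γ) (hD : IsCompact D) (hDc : Convex ℝ D)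
    (hne : D.Nonempty) (hE : IsCompact E) (hEB : E ⊆ interior B) (hDE : D ⊆ E)
    (hT : ∀ x, ponceletLift γ E x = ponceletLift γ D x) : D = E := by
  refine hDE.antisymm fun X hXE => by_contra fun hXD => ?_
  obtain ⟨f, u, hfX, hfD⟩ := geometric_hahn_banach_point_closed hDc hD.isClosed hXD
  obtain ⟨Y, hY, hmin⟩ := hD.exists_isMinOn hne f.continuous.continuousOn
  have hDB := hDE.trans hEB
  obtain ⟨p, q, hf⟩ := exists_apply_eq_coords f
  have hXY : f X < f Y := hfX.trans (hfD Y hY)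
  -- The direction of the level lines of `f`. The level line through the minimizer `Y` supports `D`
  -- and has `X` strictly on its right, so `X` would push the lift of `E` below that of `D`.
  set v : Plane := !₂[q, -p] with hv
  have hv0 : v 0 = q := by simp [hv]
  have hv1 : v 1 = -p := by simp [hv]
  have hvne : v ≠ 0 := fun h0 => by
    have hq : q = 0 := by rw [← hv0, h0]; simp
    have hp : p = 0 := by rw [← neg_eq_zero, ← hv1, h0]; simp
    simp [hf, hp, hq] at hXY
  obtain ⟨s, hs, hA'⟩ := exists_add_smul_mem_frontier h.compact (hDB hY) hvne
  obtain ⟨r, hr, hA⟩ := exists_add_smul_mem_frontier h.compact (hDB hY) (neg_ne_zero.2 hvne)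
  have ho : ∀ Z, orient (Y + r • -v) (Y + s • v) Z = (r + s) * (f Z - f Y) := fun Z => by
    simp only [orient, PiLp.add_apply, PiLp.smul_apply, PiLp.neg_apply, smul_eq_mul, hv0, hv1, hf]
    ring
  obtain ⟨x, hx⟩ := h.range_eq ▸ hA
  obtain ⟨y, hy, hyA⟩ := h.exists_mem_Ico hA' x
  have hxy : y ∈ Ioo x (x + 1) := by
    refine ⟨lt_of_le_of_ne hy.1 ?_, hy.2⟩
    rintro rfl
    have h1 : orient (Y + r • -v) (Y + s • v) X = 0 := by
      rw [← hyA, ← hx]; simp [orient]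
    rw [ho] at h1
    nlinarith
  rw [← hx, ← hyA] at ho
  have hstep : PonceletStep (frontier B) D (γ x) (γ y) :=
    ⟨h.mem_frontier x, h.mem_frontier y, h.ne_of_mem_Ioo hxy,
      fun Z hZ => by rw [ho]; have : f Y ≤ f Z := hmin hZ; nlinarith,
      Y, hY, by rw [ho, sub_self, mul_zero]⟩
  have h1 := (h.ponceletStep_iff hD hDB hne hxy).1 hstep
  have h2 := (h.orient_neg_iff (hEB hXE) hxy).1 (by rw [ho]; nlinarith)
  have h3 := h.ponceletLift_le hE hEB hXE x
  rw [hT, ← h1] at h3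
  linarith

/-- The lower bound needs all of `F s` close to `E`; for the upper bound one point of `F s` near a
minimizer in `E` is enough. -/
theorem tendsto_ponceletLift (h : IsConvexParam B γ) {ι : Type*} {l : Filter ι}
    {F : ι → Set Plane} (hE : IsCompact E) (hEB : E ⊆ interior B) (hne : E.Nonempty)
    (hF : ∀ᶠ s in l, IsCompact (F s) ∧ F s ⊆ interior B ∧ (F s).Nonempty)
    (hlim : Tendsto (fun s => Metric.hausdorffDist (F s) E) l (𝓝 0)) (x : ℝ) :
    Tendsto (fun s => ponceletLift γ (F s) x) l (𝓝 (ponceletLift γ E x)) := by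
  have hfin : ∀ᶠ s in l, Metric.hausdorffEDist (F s) E ≠ ⊤ := hF.mono fun s hs =>
    Metric.hausdorffEDist_ne_top_of_nonempty_of_bounded hs.2.2 hne hs.1.isBounded hE.isBounded
  have hcont := h.continuousOn_secondEnd_left x
  refine tendsto_order.2 ⟨fun a ha => ?_, fun a ha => ?_⟩
  · obtain ⟨δ, hδ, hU⟩ := hE.exists_thickening_subset_open
      (hcont.isOpen_inter_preimage isOpen_interior (isOpen_Ioi (a := a)))
      fun X hX => ⟨hEB hX, ha.trans_le (h.ponceletLift_le hE hEB hX x)⟩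
    filter_upwards [hF, hfin, hlim.eventually (gt_mem_nhds hδ)] with s hs hs' hsδ
    obtain ⟨X, hX, he⟩ := h.exists_ponceletLift_eq hs.1 hs.2.1 hs.2.2 x
    obtain ⟨Y, hY, hXY⟩ := Metric.exists_dist_lt_of_hausdorffDist_lt hX hsδ hs'
    exact he ▸ (hU (Metric.mem_thickening_iff.2 ⟨Y, hY, hXY⟩)).2
  · obtain ⟨X, hX, he⟩ := h.exists_ponceletLift_eq hE hEB hne x
    obtain ⟨δ, hδ, hU⟩ := Metric.mem_nhds_iff.1
      ((hcont.isOpen_inter_preimage isOpen_interior (isOpen_Iio (a := a))).mem_nhds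
        ⟨hEB hX, (he ▸ ha : secondEnd γ X x < a)⟩)
    filter_upwards [hF, hfin, hlim.eventually (gt_mem_nhds hδ)] with s hs hs' hsδ
    obtain ⟨Y, hY, hXY⟩ := Metric.exists_dist_lt_of_hausdorffDist_lt' hX hsδ hs'
    exact (h.ponceletLift_le hs.1 hs.2.1 hY x).trans_lt (hU hXY).2

end IsConvexParam

/-! ### Residues coprime to $n$ below $n/2$, and supporting lines. -/

theorem two_mul_card_filter_coprime {n : ℕ} (hn : 3 ≤ n) :
    2 * ((Finset.range n).filter fun m => 2 * m < n ∧ n.Coprime m).card = n.totient := by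
  have hsplit := Finset.card_filter_add_card_filter_not (s := (Finset.range n).filter n.Coprime)
    (fun m => 2 * m < n)
  rw [Nat.totient_eq_card_coprime, ← hsplit, two_mul, Finset.filter_filter, Finset.filter_filter]
  congr 1
  · congr 1; ext m; simp [and_comm]
  · refine Finset.card_nbij' (fun m => n - m) (fun m => n - m) ?_ ?_ ?_ ?_
    · intro m hm
      simp only [Finset.coe_filter, Finset.mem_range, mem_ofPred_eq] at hm ⊢
      have hm0 : m ≠ 0 := by rintro rfl; simp at hm; omega
      refine ⟨by omega, (Nat.coprime_self_sub_right hm.1.le).2 hm.2.2, by omega⟩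
    · intro m hm
      simp only [Finset.coe_filter, Finset.mem_range, mem_ofPred_eq] at hm ⊢
      -- The midpoint $n/2$ is coprime to $n$ only for $n=2$.
      have hm2 : 2 * m ≠ n := by
        rintro rfl
        have : m = 1 := (Nat.coprime_self m).1 (hm.2.1.coprime_dvd_left (dvd_mul_left m 2))
        omega
      refine ⟨by omega, by omega, (Nat.coprime_self_sub_right hm.1.le).2 hm.2.1⟩
    · intro m hm
      simp only [Finset.coe_filter, Finset.mem_range, mem_ofPred_eq] at hm ⊢
      omega
    · intro m hm
      simp only [Finset.coe_filter, Finset.mem_range, mem_ofPred_eq] at hm ⊢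
      omega

/-- A convex set with interior points has a supporting line at each point outside its interior. -/
theorem exists_inner_pos_of_notMem_interior {B : Set Plane} (hB : Convex ℝ B)
    (hBi : (interior B).Nonempty) {P : Plane} (hP : P ∉ interior B) :
    ∃ w : Plane, w ≠ 0 ∧ (∀ X ∈ interior B, 0 < inner ℝ w (X - P)) ∧
      ∀ X ∈ B, 0 ≤ inner ℝ w (X - P) := by
  obtain ⟨f, hf⟩ := geometric_hahn_banach_point_open hB.interior isOpen_interior hP
  set w := (InnerProductSpace.toDual ℝ Plane).symm f with hw
  have hfw : ∀ Z, inner ℝ w Z = f Z := fun Z => InnerProductSpace.toDual_symm_apply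
  have hpos : ∀ X ∈ interior B, 0 < inner ℝ w (X - P) := fun X hX => by
    rw [hfw, map_sub, sub_pos]; exact hf X hX
  refine ⟨w, ?_, hpos, fun X hX => ?_⟩
  · obtain ⟨X, hX⟩ := hBi
    intro h0
    simpa [h0] using hpos X hX
  · have hXc : X ∈ closure (interior B) := by
      rw [hB.closure_interior_eq_closure_of_nonempty_interior hBi]
      exact subset_closure hX
    have hcl : IsClosed {X : Plane | 0 ≤ inner ℝ w (X - P)} :=
      isClosed_le continuous_const (by fun_prop)
    exact closure_minimal (fun Y hY => (hpos Y hY).le) hcl hXc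

theorem exists_inner_eq_orient (A A' : Plane) (hne : A ≠ A') :
    ∃ w : Plane, w ≠ 0 ∧ ∀ X, inner ℝ w (X - A) = orient A A' X := by
  refine ⟨!₂[-(A' 1 - A 1), A' 0 - A 0], fun h => hne ?_, fun X => ?_⟩
  · have h0 := congrFun (congrArg WithLp.ofLp h) 0
    have h1 := congrFun (congrArg WithLp.ofLp h) 1
    simp at h0 h1
    ext i
    fin_cases i
    · simp; linarith
    · simp; linarith
  · rw [PiLp.inner_apply, Fin.sum_univ_two]
    simp [orient]
    ring

/-! ### The lifts of a nested family, and their limits at both ends. -/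

namespace IsNestedFamily

variable {B : Set Plane} {D : ℝ → Set Plane} {γ : ℝ → Plane} {s t : ℝ}

theorem basic (hD : IsNestedFamily B D) (ht : t ∈ Icc (0 : ℝ) 1) :
    IsCompact (D t) ∧ Convex ℝ (D t) ∧ (D t).Nonempty := by
  rcases ht.1.eq_or_lt with rfl | h0
  · obtain ⟨o, ho⟩ := hD.start
    rw [ho]
    exact ⟨isCompact_singleton, convex_singleton o, singleton_nonempty o⟩
  · have := hD.body t ⟨h0, ht.2⟩
    exact ⟨this.compact, this.convex, this.interior_nonempty.mono interior_subset⟩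

theorem subset (hD : IsNestedFamily B D) (hs : 0 ≤ s) (hst : s ≤ t) (ht : t ≤ 1) : D s ⊆ D t :=
  hD.strictMono.monotoneOn ⟨hs, hst.trans ht⟩ ⟨hs.trans hst, ht⟩ hst

theorem lift_anti (hD : IsNestedFamily B D) (h : IsConvexParam B γ) (hs : 0 ≤ s) (hst : s ≤ t)
    (ht : t < 1) (x : ℝ) : ponceletLift γ (D t) x ≤ ponceletLift γ (D s) x :=
  have ht' : t ∈ Icc (0 : ℝ) 1 := ⟨hs.trans hst, ht.le⟩
  have hs' : s ∈ Icc (0 : ℝ) 1 := ⟨hs, hst.trans ht.le⟩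
  h.ponceletLift_anti (hD.basic ht').1 (hD.inside t ⟨ht'.1, ht⟩) (hD.basic hs').1
    (hD.basic hs').2.2 (hD.subset hs hst ht.le) x

theorem exists_lift (hD : IsNestedFamily B D) (h : IsConvexParam B γ) (ht : t ∈ Ico (0 : ℝ) 1) :
    ∃ f : CircleDeg1Lift, ⇑f = ponceletLift γ (D t) ∧ StrictMono f ∧ Continuous f ∧
      ∀ x, x < f x ∧ f x < x + 1 := by
  obtain ⟨hc, -, hne⟩ := hD.basic ⟨ht.1, ht.2.le⟩
  have hB := hD.inside t ht
  obtain ⟨f, hf⟩ := h.exists_circleDeg1Lift hc hB hne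
  exact ⟨f, hf, hf ▸ h.ponceletLift_strictMono hc hB hne, hf ▸ h.continuous_ponceletLift hc hB,
    fun x => hf ▸ h.ponceletLift_mem_Ioo hc hB hne x⟩

theorem continuousOn_iterate (hD : IsNestedFamily B D) (h : IsConvexParam B γ) (x : ℝ) (k : ℕ) :
    ContinuousOn (fun t => (ponceletLift γ (D t))^[k] x) (Ico 0 1) := by
  refine _root_.continuousOn_iterate (fun t ht => ?_) (fun t ht => ?_) (fun x t ht => ?_) x k
  · obtain ⟨f, hf, hm, -⟩ := hD.exists_lift h ht
    exact hf ▸ hm.monotone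
  · obtain ⟨f, hf, -, hc, -⟩ := hD.exists_lift h ht
    exact hf ▸ hc
  · have ht' : t ∈ Icc (0 : ℝ) 1 := ⟨ht.1, ht.2.le⟩
    refine h.tendsto_ponceletLift (hD.basic ht').1 (hD.inside t ht) (hD.basic ht').2.2 ?_ ?_ x
    · filter_upwards [self_mem_nhdsWithin] with s hs
      have hs' : s ∈ Icc (0 : ℝ) 1 := ⟨hs.1, hs.2.le⟩
      exact ⟨(hD.basic hs').1, hD.inside s hs, (hD.basic hs').2.2⟩
    · exact (hD.continuous t ht').mono_left (nhdsWithin_mono _ Ico_subset_Icc_self)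

/-- At the point where the largest set touches the outer curve, the Poncelet map tends to the
identity. -/
theorem exists_lift_lt (hD : IsNestedFamily B D) (h : IsConvexParam B γ) (hB : StrictConvex ℝ B)
    (hBi : (interior B).Nonempty) {x : ℝ} (hx : γ x ∈ D 1) {ε : ℝ} (hε : 0 < ε) :
    ∃ t ∈ Ioo (0 : ℝ) 1, ponceletLift γ (D t) x < x + ε := by
  by_contra! hle
  -- If the lifts stay above `x + ε`, every `D t` lies left of the fixed chord from `γ x` to `γ y`;
  -- the cap $1/2$ keeps `y` below `x + 1`.
  set y := x + min ε (1 / 2) with hy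
  have hymem : y ∈ Ioo x (x + 1) :=
    ⟨by simp [hy, hε], by linarith [min_le_right ε (1 / 2)]⟩
  have hleft : ∀ t ∈ Ioo (0 : ℝ) 1, ∀ X ∈ D t, 0 ≤ orient (γ x) (γ y) X := by
    intro t ht X hX
    have hc := (hD.basic ⟨ht.1.le, ht.2.le⟩).1
    have hDB := hD.inside t ⟨ht.1.le, ht.2⟩
    rw [← not_lt, h.orient_neg_iff (hDB hX) hymem, not_lt]
    linarith [hle t ht, h.ponceletLift_le hc hDB hX x, min_le_left ε (1 / 2)]
  have h1 : (1 : ℝ) ∈ Icc (0 : ℝ) 1 := by simp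
  have hleft1 : ∀ X ∈ D 1, 0 ≤ orient (γ x) (γ y) X := by
    intro X hX
    have hcl : IsClosed {X | 0 ≤ orient (γ x) (γ y) X} :=
      isClosed_le continuous_const (continuous_const.orient continuous_const continuous_id)
    refine hcl.closure_subset (Metric.mem_closure_iff.2 fun δ hδ => ?_)
    have hlim := (hD.continuous 1 h1).mono_left
      (nhdsWithin_mono (1 : ℝ) (Ioo_subset_Icc_self (a := (0 : ℝ)) (b := 1)))
    have : (𝓝[Ioo (0 : ℝ) 1] 1).NeBot := right_nhdsWithin_Ioo_neBot one_pos
    obtain ⟨t, htδ, ht⟩ := ((hlim.eventually (gt_mem_nhds hδ)).and self_mem_nhdsWithin).exists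
    have hb := hD.basic ⟨ht.1.le, ht.2.le⟩
    obtain ⟨Z, hZ, hXZ⟩ := Metric.exists_dist_lt_of_hausdorffDist_lt' hX htδ
      (Metric.hausdorffEDist_ne_top_of_nonempty_of_bounded hb.2.2 (hD.basic h1).2.2
        hb.1.isBounded (hD.basic h1).1.isBounded)
    exact ⟨Z, hleft t ht Z hZ, by rwa [dist_comm]⟩
  have hfr := h.mem_frontier x
  have hne := h.ne_of_mem_Ioo hymem
  obtain ⟨w, hw, hworient⟩ := exists_inner_eq_orient _ _ hne
  obtain ⟨v, hv, hvpos, hvnn⟩ := exists_inner_pos_of_notMem_interior hB.convex hBi hfr.2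
  have hPfr : γ x ∈ frontier (D 1) :=
    ⟨subset_closure hx, fun hi => hfr.2 (interior_mono hD.subset_one hi)⟩
  have hunit : ∀ z : Plane, z ≠ 0 → (∀ X ∈ D 1, 0 ≤ inner ℝ z (X - γ x)) →
      ‖‖z‖⁻¹ • z‖ = 1 ∧ ∀ X ∈ D 1, 0 ≤ inner ℝ (‖z‖⁻¹ • z) (X - γ x) := fun z hz hX =>
    ⟨norm_smul_inv_norm (𝕜 := ℝ) hz, fun X hX' => by
      rw [real_inner_smul_left]; exact mul_nonneg (by positivity) (hX X hX')⟩
  -- The chord and a supporting line of `B` both support `D 1` at `γ x`, so their normals agree. But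
  -- the midpoint of the chord is interior to `B` by strict convexity, where one normal gives zero
  -- and the other a positive value.
  have heq := ((hD.body 1 (by simp)).unique_normal _ hPfr).unique
    (hunit w hw fun X hX => hworient X ▸ hleft1 X hX)
    (hunit v hv fun X hX => hvnn X (hD.subset_one hX))
  have hM : γ x + (1 / 2 : ℝ) • (γ y - γ x) ∈ interior B := by
    have := hB (h.compact.isClosed.frontier_subset hfr)
      (h.compact.isClosed.frontier_subset (h.mem_frontier y)) hne (a := 1 / 2) (b := 1 / 2)
      (by norm_num) (by norm_num) (by norm_num)
    convert this using 1
    module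
  have h2 := congrArg (fun z => inner ℝ z (γ x + (1 / 2 : ℝ) • (γ y - γ x) - γ x)) heq
  simp only [real_inner_smul_left, hworient, orient_lineMap, orient_self_left,
    orient_self_right] at h2
  have h3 := hvpos _ hM
  have h4 : 0 < ‖v‖⁻¹ := by positivity
  have h5 := mul_pos h4 h3
  rw [← h2] at h5
  simp at h5

theorem exists_iterate_lt (hD : IsNestedFamily B D) (h : IsConvexParam B γ)
    (hB : StrictConvex ℝ B) (hBi : (interior B).Nonempty) {x : ℝ} (hx : γ x ∈ D 1) (k : ℕ) :
    ∀ ε > 0, ∃ t ∈ Ioo (0 : ℝ) 1, (ponceletLift γ (D t))^[k] x < x + ε := by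
  induction k with
  | zero => exact fun ε hε => ⟨1 / 2, by norm_num, by simpa using hε⟩
  | succ k ih =>
    intro ε hε
    obtain ⟨s, hs, hsε⟩ := hD.exists_lift_lt h hB hBi hx hε
    obtain ⟨f, hf, hfm, hfc, -⟩ := hD.exists_lift h (t := s) ⟨hs.1.le, hs.2⟩
    rw [← hf] at hsε
    obtain ⟨z, hz, hxz⟩ := ((hfc.continuousAt.eventually (gt_mem_nhds hsε)).filter_mono
      nhdsWithin_le_nhds |>.and (self_mem_nhdsWithin (s := Ioi x))).exists
    -- `t` keeps the first `k` iterates' endpoint below `z`, and `s` keeps the last step below `x +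
    -- ε`. Lifts decrease along the family, so `max s t` achieves both.
    obtain ⟨t, ht, htz⟩ := ih (z - x) (sub_pos.2 hxz)
    have hmax : max s t ∈ Ioo (0 : ℝ) 1 := ⟨lt_max_of_lt_left hs.1, max_lt hs.2 ht.2⟩
    obtain ⟨g, hg, hgm, -⟩ := hD.exists_lift h (t := max s t) ⟨hmax.1.le, hmax.2⟩
    refine ⟨max s t, hmax, ?_⟩
    rw [← hg, Function.iterate_succ_apply']
    have h1 : g^[k] x ≤ (ponceletLift γ (D t))^[k] x :=
      g.monotone.iterate_le_of_le
        (fun y => hg ▸ hD.lift_anti h ht.1.le (le_max_right s t) hmax.2 y) k x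
    calc g (g^[k] x) ≤ g z := g.monotone (by linarith)
      _ ≤ f z := by rw [hg, hf]; exact hD.lift_anti h hs.1.le (le_max_left s t) hmax.2 z
      _ < x + ε := hz

theorem start_iterate_two (hD : IsNestedFamily B D) (h : IsConvexParam B γ) (x : ℝ) :
    ponceletLift γ (D 0) (ponceletLift γ (D 0) x) = x + 1 := by
  obtain ⟨o, ho⟩ := hD.start
  have hoB : o ∈ interior B := hD.inside 0 (by simp) (by simp [ho])
  have hl : ∀ y, ponceletLift γ (D 0) y = secondEnd γ o y := fun y => by simp [ponceletLift, ho]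
  rw [hl, hl, h.secondEnd_secondEnd hoB]

end IsNestedFamily

/-! ### Counting the pairs of a nested family. -/

namespace IsNestedFamily

variable {B : Set Plane} {D : ℝ → Set Plane} {γ : ℝ → Plane} {s t x : ℝ} {n : ℕ}

theorem closes_iff (hD : IsNestedFamily B D) (h : IsConvexParam B γ) (ht : t ∈ Ioo (0 : ℝ) 1)
    (hn : 0 < n) (x : ℝ) :
    PonceletCloses n (frontier B) (frontier (D t)) (γ x) ↔
      ∃ m : ℤ, (ponceletLift γ (D t))^[n] x = x + m ∧ Int.gcd m n = 1 := by
  obtain ⟨hc, -, hne⟩ := hD.basic ⟨ht.1.le, ht.2.le⟩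
  have hDB := hD.inside t ⟨ht.1.le, ht.2⟩
  obtain ⟨f, hf, -⟩ := hD.exists_lift h (t := t) ⟨ht.1.le, ht.2⟩
  rw [h.ponceletCloses_iff (hc.of_isClosed_subset isClosed_frontier hc.isClosed.frontier_subset)
    (hc.isClosed.frontier_subset.trans hDB) (h.frontier_nonempty hc hDB hne),
    h.ponceletLift_frontier hc hDB hne, ← hf]
  constructor
  · rintro ⟨⟨m, hm⟩, hk⟩
    exact ⟨m, hm, f.gcd_eq_one_of_first_return hn hm hk⟩
  · rintro ⟨m, hm, hg⟩
    exact ⟨⟨m, hm⟩, fun k h0 hk => f.not_exists_return_of_gcd_eq_one hm hg h0 hk⟩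

theorem start_iterate (hD : IsNestedFamily B D) (h : IsConvexParam B γ) (n : ℕ) (x : ℝ) :
    (ponceletLift γ (D 0))^[n * 2] x = x + n := by
  obtain ⟨f, hf, -⟩ := hD.exists_lift h (t := 0) (by simp)
  have := (f ^ 2).iterate_eq_of_map_eq_add_int (x := x) (m := 1)
    (by rw [CircleDeg1Lift.coe_pow]
        simpa [hf] using hD.start_iterate_two h x) n
  rw [CircleDeg1Lift.coe_pow, ← Function.iterate_mul, hf] at this
  simpa [mul_comm] using this

/-- The closure property allows testing at one base point. Comparison of $2n$ steps with the lift of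
`D 0` gives $2m\le n$; equality with $\gcd(m,n)=1$ would force $n=2$. -/
theorem isPonceletPair_iff (hD : IsNestedFamily B D) (h : IsConvexParam B γ)
    (ht : t ∈ Ioo (0 : ℝ) 1) (hcl : HasPonceletClosure (frontier B) (frontier (D t)))
    (hn : 3 ≤ n) (x : ℝ) :
    IsPonceletPair n (frontier B) (frontier (D t)) ↔
      ∃ m : ℕ, 2 * m < n ∧ n.Coprime m ∧ (ponceletLift γ (D t))^[n] x = x + m := by
  have hn0 : 0 < n := by omega
  constructor
  · intro hp
    obtain ⟨m, hm, hg⟩ := (hD.closes_iff h ht hn0 x).1 (hcl n hn0 hp _ (h.mem_frontier x))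
    obtain ⟨f, hf, hfm, -, hfx⟩ := hD.exists_lift h (t := t) ⟨ht.1.le, ht.2⟩
    have hm0 : 0 < m := by
      have := (f.lt_iterate_pos_iff (x := x) (m := 0) hn0).2 (by simpa using (hfx x).1)
      rw [hf, hm] at this
      simpa using this
    lift m to ℕ using hm0.le
    refine ⟨m, ?_, by simpa [Nat.Coprime, Nat.gcd_comm] using hg, by simpa using hm⟩
    have h2 : (ponceletLift γ (D t))^[n * 2] x = x + 2 * m := by
      have := (f ^ n).iterate_eq_of_map_eq_add_int (x := x) (m := m)
        (by rw [CircleDeg1Lift.coe_pow, hf, hm]) 2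
      rw [CircleDeg1Lift.coe_pow, ← Function.iterate_mul, hf] at this
      simpa using this
    have h3 := f.monotone.iterate_le_of_le
      (fun y => hf ▸ hD.lift_anti h le_rfl ht.1.le ht.2 y) (n * 2) x
    rw [hf, h2, hD.start_iterate h] at h3
    have h4 : 2 * m ≤ n := by
      have : (2 * m : ℝ) ≤ n := by linarith
      exact_mod_cast this
    refine lt_of_le_of_ne h4 fun h5 => ?_
    have h6 : m ∣ Int.gcd m n := by
      rw [Int.gcd_natCast_natCast, ← h5]
      exact Nat.dvd_gcd dvd_rfl (dvd_mul_left _ _)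
    rw [hg, Nat.dvd_one] at h6
    omega
  · rintro ⟨m, -, hg, hm⟩
    exact h.isPonceletPair_iff.2 ⟨x, (hD.closes_iff h ht hn0 x).2
      ⟨m, by simpa using hm, by simpa [Nat.Coprime, Nat.gcd_comm] using hg⟩⟩

/-- Closure only gives some integer shift at each `y`; the translation number, common to all points,
makes it the same `m`. -/
theorem iterate_eq_add (hD : IsNestedFamily B D) (h : IsConvexParam B γ)
    (ht : t ∈ Ioo (0 : ℝ) 1) (hcl : HasPonceletClosure (frontier B) (frontier (D t)))
    (hn : 0 < n) {m : ℕ} (hg : n.Coprime m) (hx : (ponceletLift γ (D t))^[n] x = x + m) (y : ℝ) :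
    (ponceletLift γ (D t))^[n] y = y + (m : ℤ) := by
  have hx' : (ponceletLift γ (D t))^[n] x = x + (m : ℤ) := by simpa using hx
  have hc := (hD.closes_iff h ht hn x).2 ⟨m, hx', by simpa [Nat.Coprime, Nat.gcd_comm] using hg⟩
  obtain ⟨m', hm', -⟩ := (hD.closes_iff h ht hn y).1
    (hcl n hn (h.isPonceletPair_iff.2 ⟨x, hc⟩) _ (h.mem_frontier y))
  obtain ⟨f, hf, -⟩ := hD.exists_lift h (t := t) ⟨ht.1.le, ht.2⟩
  have h1 := f.translationNumber_of_map_pow_eq_add_int (by rwa [CircleDeg1Lift.coe_pow, hf]) hn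
    (x := x) (m := m)
  have h2 := f.translationNumber_of_map_pow_eq_add_int (by rwa [CircleDeg1Lift.coe_pow, hf]) hn
    (x := y) (m := m')
  have hn' : (n : ℝ) ≠ 0 := by positivity
  rw [h1, div_left_inj' hn'] at h2
  rw [hm', ← h2]

theorem eq_of_iterate_eq (hD : IsNestedFamily B D) (h : IsConvexParam B γ)
    (hcl : ∀ t ∈ Ioo (0 : ℝ) 1, HasPonceletClosure (frontier B) (frontier (D t)))
    (hn : 0 < n) {m : ℕ} (hg : n.Coprime m) (hs : s ∈ Ioo (0 : ℝ) 1) (ht : t ∈ Ioo (0 : ℝ) 1)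
    (hsx : (ponceletLift γ (D s))^[n] x = x + m) (htx : (ponceletLift γ (D t))^[n] x = x + m) :
    s = t := by
  wlog hst : s ≤ t generalizing s t
  · exact (this ht hs htx hsx (le_of_not_ge hst)).symm
  obtain ⟨f, hf, hfm, -⟩ := hD.exists_lift h (t := s) ⟨hs.1.le, hs.2⟩
  obtain ⟨g, hg', hgm, -⟩ := hD.exists_lift h (t := t) ⟨ht.1.le, ht.2⟩
  have heq := CircleDeg1Lift.eq_of_le_of_iterate_eq (f := g) (g := f) hgm
    (fun y => hg' ▸ hf ▸ hD.lift_anti h hs.1.le hst ht.2 y) hn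
    (hg' ▸ hD.iterate_eq_add h ht (hcl t ht) hn hg htx)
    (hf ▸ hD.iterate_eq_add h hs (hcl s hs) hn hg hsx)
  have hs' : s ∈ Icc (0 : ℝ) 1 := ⟨hs.1.le, hs.2.le⟩
  have ht' : t ∈ Icc (0 : ℝ) 1 := ⟨ht.1.le, ht.2.le⟩
  obtain ⟨hsc, hsv, hsn⟩ := hD.basic hs'
  have := h.eq_of_ponceletLift_eq hsc hsv hsn (hD.basic ht').1 (hD.inside t ⟨ht.1.le, ht.2⟩)
    (hD.subset hs.1.le hst ht.2.le) (fun y => by rw [← hf, ← hg', heq])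
  exact hD.strictMono.injOn hs' ht' this

theorem exists_iterate_eq (hD : IsNestedFamily B D) (h : IsConvexParam B γ)
    (hB : StrictConvex ℝ B) (hBi : (interior B).Nonempty) (hx : γ x ∈ D 1) {m : ℕ} (hm : 0 < m)
    (hmn : 2 * m < n) : ∃ t ∈ Ioo (0 : ℝ) 1, (ponceletLift γ (D t))^[n] x = x + m := by
  -- Otherwise $2n$ steps at $t=0$ would advance `x` by at most $2m<n$, not by $n$.
  have h0 : x + m < (ponceletLift γ (D 0))^[n] x := by
    by_contra! hle
    obtain ⟨f, hf, -⟩ := hD.exists_lift h (t := 0) (by simp)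
    have := (f ^ n).iterate_le_of_map_le_add_int (x := x) (m := m)
      (by simpa [CircleDeg1Lift.coe_pow, hf] using hle) 2
    rw [CircleDeg1Lift.coe_pow, ← Function.iterate_mul, hf, hD.start_iterate h] at this
    have h2 : (n : ℝ) ≤ 2 * m := by simpa using this
    have h3 : n ≤ 2 * m := by exact_mod_cast h2
    omega
  obtain ⟨t, ht, htx⟩ := hD.exists_iterate_lt h hB hBi hx n 1 one_pos
  have hm1 : (1 : ℝ) ≤ m := by exact_mod_cast hm
  obtain ⟨r, hr, hrx⟩ := intermediate_value_Icc' ht.1.le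
    ((hD.continuousOn_iterate h x n).mono fun r hr => ⟨hr.1, hr.2.trans_lt ht.2⟩)
    (show x + m ∈ Icc _ _ from ⟨by linarith, h0.le⟩)
  refine ⟨r, ⟨lt_of_le_of_ne hr.1 ?_, hr.2.trans_lt ht.2⟩, hrx⟩
  rintro rfl
  exact h0.ne' hrx

theorem hasHalfTotientMany (hD : IsNestedFamily B D) (h : IsConvexParam B γ)
    (hB : StrictConvex ℝ B) (hBi : (interior B).Nonempty)
    (hcl : ∀ t ∈ Ioo (0 : ℝ) 1, HasPonceletClosure (frontier B) (frontier (D t)))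
    (hn : 3 ≤ n) :
    HasHalfTotientMany n {L | ∃ t ∈ Ioo (0 : ℝ) 1,
      L = frontier (D t) ∧ IsPonceletPair n (frontier B) L} := by
  have hn0 : 0 < n := by omega
  obtain ⟨P, hP1, hPB⟩ := hD.touch
  obtain ⟨x, rfl⟩ := h.range_eq ▸ hPB
  set M := (Finset.range n).filter fun m => 2 * m < n ∧ n.Coprime m with hM
  have hMmem : ∀ m, m ∈ M ↔ 2 * m < n ∧ n.Coprime m := fun m => by
    simp only [hM, Finset.mem_filter, Finset.mem_range, and_iff_right_iff_imp]
    omega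
  have hex : ∀ m ∈ M, ∃ t ∈ Ioo (0 : ℝ) 1, (ponceletLift γ (D t))^[n] x = x + m := fun m hm => by
    rw [hMmem] at hm
    refine hD.exists_iterate_eq h hB hBi hP1 (Nat.pos_of_ne_zero ?_) hm.1
    rintro rfl
    simp at hm
    omega
  choose! τ hτ hτx using hex
  have hS : {L | ∃ t ∈ Ioo (0 : ℝ) 1, L = frontier (D t) ∧ IsPonceletPair n (frontier B) L} =
      (fun m => frontier (D (τ m))) '' (M : Set ℕ) := by
    ext L
    constructor
    · rintro ⟨t, ht, rfl, hp⟩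
      obtain ⟨m, hmn, hmc, hmx⟩ := (hD.isPonceletPair_iff h ht (hcl t ht) hn x).1 hp
      have hm := (hMmem m).2 ⟨hmn, hmc⟩
      refine ⟨m, hm, ?_⟩
      simp only [hD.eq_of_iterate_eq h hcl hn0 hmc (hτ m hm) ht (hτx m hm) hmx]
    · rintro ⟨m, hm, rfl⟩
      have hm' := (hMmem m).1 hm
      exact ⟨τ m, hτ m hm, rfl, (hD.isPonceletPair_iff h (hτ m hm) (hcl _ (hτ m hm)) hn x).2
        ⟨m, hm'.1, hm'.2, hτx m hm⟩⟩
  -- Curves are counted, not parameters: a curve determines its lift, whose $n$-th iterate at `x`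
  -- recovers `m`.
  have hinj : InjOn (fun m => frontier (D (τ m))) (M : Set ℕ) := by
    intro m hm k hk he
    have hfr : ∀ m ∈ M, ponceletLift γ (frontier (D (τ m))) = ponceletLift γ (D (τ m)) :=
      fun m hm => by
        obtain ⟨hc, -, hne⟩ := hD.basic (t := τ m) ⟨(hτ m hm).1.le, (hτ m hm).2.le⟩
        exact h.ponceletLift_frontier hc (hD.inside _ ⟨(hτ m hm).1.le, (hτ m hm).2⟩) hne
    have h1 := hτx m hm
    rw [← hfr m hm, show frontier (D (τ m)) = frontier (D (τ k)) from he, hfr k hk,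
      hτx k hk] at h1
    exact_mod_cast (add_left_cancel h1).symm
  rw [hS]
  refine ⟨M.finite_toSet.image _, ?_⟩
  rw [hinj.ncard_image, ncard_coe_finset, ← two_mul_card_filter_coprime hn]
  push_cast
  ring

end IsNestedFamily

/-! ### Polar parametrization of a strictly convex curve. -/

/-- The unit vector whose angle with the first axis is `x` full turns. -/
noncomputable def turnVec (x : ℝ) : Plane :=
  !₂[Real.cos (2 * Real.pi * x), Real.sin (2 * Real.pi * x)]

@[simp] theorem turnVec_zero (x : ℝ) : turnVec x 0 = Real.cos (2 * Real.pi * x) := rfl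

@[simp] theorem turnVec_one (x : ℝ) : turnVec x 1 = Real.sin (2 * Real.pi * x) := rfl

theorem norm_turnVec (x : ℝ) : ‖turnVec x‖ = 1 := by
  simp [EuclideanSpace.norm_eq, Fin.sum_univ_two]

theorem turnVec_ne_zero (x : ℝ) : turnVec x ≠ 0 := fun h => by
  simpa [h] using norm_turnVec x

theorem turnVec_add_one (x : ℝ) : turnVec (x + 1) = turnVec x := by
  ext i
  fin_cases i <;> simp [mul_add]

theorem continuous_turnVec : Continuous turnVec := by
  refine (PiLp.continuous_toLp 2 _).comp (continuous_pi fun i => ?_)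
  fin_cases i <;> simp <;> fun_prop

theorem exists_eq_smul_turnVec (v : Plane) : ∃ p x : ℝ, 0 ≤ p ∧ v = p • turnVec x := by
  set z : ℂ := ⟨v 0, v 1⟩
  have hx : 2 * Real.pi * (z.arg / (2 * Real.pi)) = z.arg := by
    field_simp
  refine ⟨‖z‖, z.arg / (2 * Real.pi), norm_nonneg _, ?_⟩
  ext i
  fin_cases i
  · simp [hx, Complex.norm_mul_cos_arg, z]
  · simp [hx, Complex.norm_mul_sin_arg, z]

theorem sin_smul_turnVec (a b c : ℝ) :
    Real.sin (2 * Real.pi * (c - a)) • turnVec b =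
      Real.sin (2 * Real.pi * (c - b)) • turnVec a +
        Real.sin (2 * Real.pi * (b - a)) • turnVec c := by
  ext i
  fin_cases i
  · simp [mul_sub, Real.sin_sub]; ring
  · simp [mul_sub, Real.sin_sub]; ring

/-- The doubled area of a triangle is the sum of the signed doubled areas of the three triangles it
spans with `o`. -/
theorem orient_polar (o : Plane) (p q r a b c : ℝ) :
    orient (o + p • turnVec a) (o + q • turnVec b) (o + r • turnVec c) =
      p * q * Real.sin (2 * Real.pi * (b - a)) + q * r * Real.sin (2 * Real.pi * (c - b)) -
        p * r * Real.sin (2 * Real.pi * (c - a)) := by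
  simp [orient, mul_sub, Real.sin_sub]; ring

theorem sin_two_pi_mul_pos {x : ℝ} (h0 : 0 < x) (h1 : x < 1 / 2) :
    0 < Real.sin (2 * Real.pi * x) :=
  Real.sin_pos_of_pos_of_lt_pi (by positivity) (by nlinarith [Real.pi_pos])

theorem sin_two_pi_mul_nonneg {x : ℝ} (h0 : 0 ≤ x) (h1 : x ≤ 1 / 2) :
    0 ≤ Real.sin (2 * Real.pi * x) :=
  Real.sin_nonneg_of_nonneg_of_le_pi (by positivity) (by nlinarith [Real.pi_pos])

theorem sin_two_pi_mul_nonpos {x : ℝ} (h0 : 1 / 2 ≤ x) (h1 : x ≤ 1) :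
    Real.sin (2 * Real.pi * x) ≤ 0 := by
  have := sin_two_pi_mul_nonneg (x := 1 - x) (by linarith) (by linarith)
  rw [mul_sub, mul_one, Real.sin_two_pi_sub] at this
  linarith

/-- The parametrization of the boundary of `B` by the angle at `o`. -/
noncomputable def polarParam (B : Set Plane) (o : Plane) (x : ℝ) : Plane :=
  o + (gauge ((o + ·) ⁻¹' B) (turnVec x))⁻¹ • turnVec x

theorem isConvexParam_polarParam {B : Set Plane} (hB : IsCompact B) (hBc : StrictConvex ℝ B)
    {o : Plane} (ho : o ∈ interior B) : IsConvexParam B (polarParam B o) := by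
  set S : Set Plane := (o + ·) ⁻¹' B with hS
  have hSint : interior S = (o + ·) ⁻¹' interior B :=
    ((Homeomorph.addLeft o).preimage_interior B).symm
  have hSfr : frontier S = (o + ·) ⁻¹' frontier B :=
    ((Homeomorph.addLeft o).preimage_frontier B).symm
  have hSc : Convex ℝ S := hBc.convex.translate_preimage_right o
  have hSnhds : S ∈ 𝓝 (0 : Plane) :=
    mem_of_superset (isOpen_interior.mem_nhds (by rw [hSint]; simpa using ho)) interior_subset
  have hSb : Bornology.IsBounded S :=
    ((Homeomorph.addLeft o).isCompact_preimage.2 hB).isBounded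
  have hg : ∀ v : Plane, v ≠ 0 → 0 < gauge S v := fun v hv =>
    (gauge_pos (absorbent_nhds_zero hSnhds) (NormedSpace.isVonNBounded_iff ℝ |>.2 hSb)).2 hv
  have hgt : ∀ x, 0 < gauge S (turnVec x) := fun x => hg _ (turnVec_ne_zero x)
  have hper : Function.Periodic (polarParam B o) 1 := fun x => by
    simp only [polarParam, turnVec_add_one]
  have hfr : ∀ x, polarParam B o x ∈ frontier B := fun x => by
    have : (gauge S (turnVec x))⁻¹ • turnVec x ∈ frontier S := by
      rw [← gauge_eq_one_iff_mem_frontier hSc hSnhds,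
        gauge_smul_of_nonneg (inv_nonneg.2 (hgt x).le), smul_eq_mul,
        inv_mul_cancel₀ (hgt x).ne']
    rwa [hSfr] at this
  have hcl : ∀ x, polarParam B o x ∈ B := fun x => hB.isClosed.frontier_subset (hfr x)
  -- Within half a turn, the ray of angle `b` meets the chord from `a` to `c` in an interior point
  -- of `B`, by strict convexity, hence before it reaches the boundary. The weights that locate this
  -- point come from `sin_smul_turnVec`.
  have hsmall : ∀ a b c, a < b → b < c → c < a + 1 / 2 →
      0 < orient (polarParam B o a) (polarParam B o b) (polarParam B o c) := by
    intro a b c hab hbc hca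
    have hs1 := sin_two_pi_mul_pos (x := b - a) (by linarith) (by linarith)
    have hs2 := sin_two_pi_mul_pos (x := c - b) (by linarith) (by linarith)
    have hs3 := sin_two_pi_mul_pos (x := c - a) (by linarith) (by linarith)
    have hid := sin_smul_turnVec a b c
    have hA : polarParam B o a = o + (gauge S (turnVec a))⁻¹ • turnVec a := rfl
    have hC : polarParam B o c = o + (gauge S (turnVec c))⁻¹ • turnVec c := rfl
    have hp := inv_pos.2 (hgt a)
    have hr := inv_pos.2 (hgt c)
    have hne : polarParam B o a ≠ polarParam B o c := by
      intro he
      have h0 := orient_polar o 0 (gauge S (turnVec a))⁻¹ (gauge S (turnVec c))⁻¹ 0 a c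
      rw [← hA, ← hC, he, orient_self_right] at h0
      have := mul_pos (mul_pos hp hr) hs3
      linarith
    have hw1 := mul_pos hp hs1
    have hw2 := mul_pos hr hs2
    have hZ := hBc (hcl a) (hcl c) hne (div_pos hw2 (add_pos hw1 hw2))
      (div_pos hw1 (add_pos hw1 hw2))
      (by rw [← add_div, add_comm, div_self (add_pos hw1 hw2).ne'])
    have hq := hgt b
    unfold polarParam
    rw [orient_polar]
    rw [hA, hC] at hZ
    generalize (gauge S (turnVec a))⁻¹ = p at *
    generalize (gauge S (turnVec c))⁻¹ = r at *
    generalize Real.sin (2 * Real.pi * (b - a)) = σ at *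
    generalize Real.sin (2 * Real.pi * (c - b)) = τ at *
    generalize Real.sin (2 * Real.pi * (c - a)) = υ at *
    have hsum := add_pos hw1 hw2
    have hZ' : (p * r * υ / (p * σ + r * τ)) • turnVec b ∈ interior S := by
      rw [hSint, mem_preimage]
      convert hZ using 1
      have e1 : (p * r * υ / (p * σ + r * τ)) • turnVec b =
          (p * r / (p * σ + r * τ)) • (υ • turnVec b) := by
        rw [smul_smul]; congr 1; ring
      have e2 : r * τ / (p * σ + r * τ) + p * σ / (p * σ + r * τ) = 1 := by
        field_simp; ring
      rw [e1, hid, smul_add, smul_add, smul_add, add_add_add_comm, ← add_smul, e2, one_smul]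
      simp only [smul_smul]
      congr 2
      · congr 1; ring
      · congr 1; ring
    rw [← gauge_lt_one_iff_mem_interior hSc hSnhds,
      gauge_smul_of_nonneg (by positivity), smul_eq_mul, ← lt_div_iff₀ hq, one_div,
      div_lt_iff₀ hsum] at hZ'
    change 0 < p * (gauge S (turnVec b))⁻¹ * σ + (gauge S (turnVec b))⁻¹ * r * τ - p * r * υ
    linarith
  refine ⟨hB, ?_, hper, ?_, fun a b c hab hbc hca => ?_⟩
  · exact continuous_const.add ((((continuous_gauge hSc hSnhds).comp continuous_turnVec).inv₀
      fun x => (hgt x).ne').smul continuous_turnVec)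
  · refine Subset.antisymm (range_subset_iff.2 hfr) fun P hP => ?_
    obtain ⟨p, x, hp, hpx⟩ := exists_eq_smul_turnVec (P - o)
    have h1 : P - o ∈ frontier S := by rw [hSfr]; simpa using hP
    rw [hpx, ← gauge_eq_one_iff_mem_frontier hSc hSnhds, gauge_smul_of_nonneg hp,
      smul_eq_mul] at h1
    refine ⟨x, ?_⟩
    change o + (gauge S (turnVec x))⁻¹ • turnVec x = P
    rw [← eq_inv_of_mul_eq_one_left h1, ← hpx]
    abel
  -- If one cyclic gap exceeds half a turn, the triple is rotated into the previous case. Otherwise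
  -- `o` lies in the closed triangle: the three partial areas are nonnegative and one of the first
  -- two is positive.
  · rcases lt_or_ge (c - a) (1 / 2) with h1 | h1
    · exact hsmall a b c hab hbc (by linarith)
    rcases lt_or_ge (1 / 2) (c - b) with h2 | h2
    · have := hsmall c (a + 1) (b + 1) hca (by linarith) (by linarith)
      rwa [hper, hper, orient_rotate] at this
    rcases lt_or_ge (1 / 2) (b - a) with h3 | h3
    · have := hsmall b c (a + 1) hbc hca (by linarith)
      rwa [hper, ← orient_rotate] at this
    unfold polarParam
    rw [orient_polar]
    have hp := inv_pos.2 (hgt a)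
    have hq := inv_pos.2 (hgt b)
    have hr := inv_pos.2 (hgt c)
    have n1 := mul_nonneg (mul_pos hp hq).le
      (sin_two_pi_mul_nonneg (x := b - a) (by linarith) h3)
    have n2 := mul_nonneg (mul_pos hq hr).le
      (sin_two_pi_mul_nonneg (x := c - b) (by linarith) h2)
    have n3 := mul_nonpos_of_nonneg_of_nonpos (mul_pos hp hr).le
      (sin_two_pi_mul_nonpos (x := c - a) h1 (by linarith))
    rcases h3.lt_or_eq with h4 | h4
    · have := mul_pos (mul_pos hp hq) (sin_two_pi_mul_pos (x := b - a) (by linarith) h4)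
      change 0 < (gauge S (turnVec a))⁻¹ * _ * _ + _ - _
      linarith
    · have := mul_pos (mul_pos hq hr)
        (sin_two_pi_mul_pos (x := c - b) (by linarith) (by linarith))
      change 0 < (gauge S (turnVec a))⁻¹ * _ * _ + _ - _
      linarith

theorem isConvexParam_circle (C : Plane) {R : ℝ} (hR : 0 < R) :
    IsConvexParam (Metric.closedBall C R) fun x => C + R • turnVec x := by
  have h := isConvexParam_polarParam (isCompact_closedBall C R)
    (strictConvex_closedBall ℝ C R) (o := C)
    (Metric.ball_subset_interior_closedBall (Metric.mem_ball_self hR))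
  convert h using 1
  ext1 x
  have : (C + ·) ⁻¹' Metric.closedBall C R = Metric.closedBall 0 R := by
    ext v; simp
  rw [polarParam, this, gauge_closedBall hR.le, norm_turnVec]
  simp

/-! ### The closure property for two nested circles

The outer circle has radius `R` and centre `(a, b)`, the inner circle has radius `r` and centre
`0`. -/

/-- The length of the tangents from the point of angle `θ` on the outer circle to the inner one. -/
noncomputable def tangentLength (a b R r θ : ℝ) : ℝ :=
  √((a + R * Real.cos θ) ^ 2 + (b + R * Real.sin θ) ^ 2 - r ^ 2)

/-- The angle at the centre of the outer circle that spans half the chord that touches the inner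
circle in the direction `φ`. -/
noncomputable def halfArc (a b R r φ : ℝ) : ℝ :=
  Real.arccos ((r - (a * Real.cos φ + b * Real.sin φ)) / R)

theorem abs_dot_le_sqrt (a b φ : ℝ) :
    |a * Real.cos φ + b * Real.sin φ| ≤ √(a ^ 2 + b ^ 2) := by
  refine Real.abs_le_sqrt ?_
  nlinarith [sq_nonneg (a * Real.sin φ - b * Real.cos φ), Real.sin_sq_add_cos_sq φ]

/-- `R`, `r` are the radii and `(a, b)` is the vector between the centres of two circles, the
second inside the first. -/
structure IsNestedRadii (a b R r : ℝ) : Prop where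
  pos : 0 < r
  lt : √(a ^ 2 + b ^ 2) + r < R

namespace IsNestedRadii

variable {a b R r : ℝ}

theorem radius_pos (H : IsNestedRadii a b R r) : 0 < R :=
  (add_pos_of_nonneg_of_pos (Real.sqrt_nonneg _) H.pos).trans H.lt

theorem abs_div_lt_one (H : IsNestedRadii a b R r) (φ : ℝ) :
    |(r - (a * Real.cos φ + b * Real.sin φ)) / R| < 1 := by
  rw [abs_div, abs_of_pos H.radius_pos, div_lt_one H.radius_pos]
  have := abs_dot_le_sqrt a b φ
  calc |r - (a * Real.cos φ + b * Real.sin φ)| ≤ |r| + |a * Real.cos φ + b * Real.sin φ| :=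
        abs_sub _ _
    _ < R := by rw [abs_of_pos H.pos]; linarith [H.lt]

theorem cos_halfArc (H : IsNestedRadii a b R r) (φ : ℝ) :
    R * Real.cos (halfArc a b R r φ) = r - (a * Real.cos φ + b * Real.sin φ) := by
  have := abs_lt.1 (H.abs_div_lt_one φ)
  rw [halfArc, Real.cos_arccos this.1.le this.2.le, mul_div_cancel₀ _ H.radius_pos.ne']

theorem halfArc_mem (H : IsNestedRadii a b R r) (φ : ℝ) : halfArc a b R r φ ∈ Ioo 0 Real.pi := by
  have := abs_lt.1 (H.abs_div_lt_one φ)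
  exact ⟨Real.arccos_pos.2 this.2, lt_of_le_of_ne (Real.arccos_le_pi _) fun h =>
    this.1.not_ge (Real.arccos_eq_pi.1 h)⟩

theorem sin_halfArc_pos (H : IsNestedRadii a b R r) (φ : ℝ) : 0 < Real.sin (halfArc a b R r φ) :=
  Real.sin_pos_of_mem_Ioo (H.halfArc_mem φ)

/-- The left side is the distance between the midpoint of the tangent chord and its point of
contact; the right side is half the chord. So the contact point is strictly inside the chord. -/
theorem abs_lt_halfChord (H : IsNestedRadii a b R r) (φ : ℝ) :
    |b * Real.cos φ - a * Real.sin φ| < R * Real.sin (halfArc a b R r φ) := by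
  have hc := H.cos_halfArc φ
  refine abs_lt_of_sq_lt_sq ?_ (mul_pos H.radius_pos (H.sin_halfArc_pos φ)).le
  have h1 : (R * Real.sin (halfArc a b R r φ)) ^ 2 =
      R ^ 2 - (r - (a * Real.cos φ + b * Real.sin φ)) ^ 2 := by
    rw [← hc, mul_pow, mul_pow, Real.sin_sq]; ring
  have h2 : (b * Real.cos φ - a * Real.sin φ) ^ 2 =
      a ^ 2 + b ^ 2 - (a * Real.cos φ + b * Real.sin φ) ^ 2 := by
    linear_combination (-(a ^ 2 + b ^ 2)) * (-Real.sin_sq_add_cos_sq φ)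
  have h3 := (abs_le.1 (abs_dot_le_sqrt a b φ)).1
  have h4 : √(a ^ 2 + b ^ 2) ^ 2 = a ^ 2 + b ^ 2 := Real.sq_sqrt (by positivity)
  have h5 := pow_lt_pow_left₀ H.lt (add_nonneg (Real.sqrt_nonneg _) H.pos.le) two_ne_zero
  rw [h1, h2, ← h4]
  nlinarith [mul_le_mul_of_nonneg_left h3 H.pos.le]

/-- In the frame of the normal and the tangent at the contact point, this chord endpoint has
coordinates `r` and the right-hand side; the latter is its tangent length. -/
theorem tangentLength_add (H : IsNestedRadii a b R r) (φ : ℝ) :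
    tangentLength a b R r (φ + halfArc a b R r φ) =
      R * Real.sin (halfArc a b R r φ) + (b * Real.cos φ - a * Real.sin φ) := by
  have hc := H.cos_halfArc φ
  have hs := Real.sin_sq_add_cos_sq φ
  have hlt := abs_lt.1 (H.abs_lt_halfChord φ)
  rw [tangentLength, Real.sqrt_eq_iff_mul_self_eq_of_pos (by linarith), Real.cos_add, Real.sin_add]
  generalize halfArc a b R r φ = α at *
  have e1 : a + R * (Real.cos φ * Real.cos α - Real.sin φ * Real.sin α) =
      r * Real.cos φ - (R * Real.sin α + (b * Real.cos φ - a * Real.sin φ)) * Real.sin φ := by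
    linear_combination Real.cos φ * hc - a * hs
  have e2 : b + R * (Real.sin φ * Real.cos α + Real.cos φ * Real.sin α) =
      r * Real.sin φ + (R * Real.sin α + (b * Real.cos φ - a * Real.sin φ)) * Real.cos φ := by
    linear_combination Real.sin φ * hc - b * hs
  rw [e1, e2]
  linear_combination
    (-(R * Real.sin α + (b * Real.cos φ - a * Real.sin φ)) ^ 2 - r ^ 2) * hs

theorem tangentLength_sub (H : IsNestedRadii a b R r) (φ : ℝ) :
    tangentLength a b R r (φ - halfArc a b R r φ) =
      R * Real.sin (halfArc a b R r φ) - (b * Real.cos φ - a * Real.sin φ) := by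
  have hc := H.cos_halfArc φ
  have hs := Real.sin_sq_add_cos_sq φ
  have hlt := abs_lt.1 (H.abs_lt_halfChord φ)
  rw [tangentLength, Real.sqrt_eq_iff_mul_self_eq_of_pos (by linarith), Real.cos_sub, Real.sin_sub]
  generalize halfArc a b R r φ = α at *
  have e1 : a + R * (Real.cos φ * Real.cos α + Real.sin φ * Real.sin α) =
      r * Real.cos φ + (R * Real.sin α - (b * Real.cos φ - a * Real.sin φ)) * Real.sin φ := by
    linear_combination Real.cos φ * hc - a * hs
  have e2 : b + R * (Real.sin φ * Real.cos α - Real.cos φ * Real.sin α) =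
      r * Real.sin φ - (R * Real.sin α - (b * Real.cos φ - a * Real.sin φ)) * Real.cos φ := by
    linear_combination Real.sin φ * hc - b * hs
  rw [e1, e2]
  linear_combination
    (-(R * Real.sin α - (b * Real.cos φ - a * Real.sin φ)) ^ 2 - r ^ 2) * hs

/-- With $u$ the half chord and $v$ the offset of its midpoint from the contact point, the
derivative is $v/u$. -/
theorem hasDerivAt_halfArc (H : IsNestedRadii a b R r) (φ : ℝ) : HasDerivAt (halfArc a b R r)
    ((b * Real.cos φ - a * Real.sin φ) / (R * Real.sin (halfArc a b R r φ))) φ := by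
  have hlt := abs_lt.1 (H.abs_div_lt_one φ)
  have h1 : HasDerivAt (fun φ => (r - (a * Real.cos φ + b * Real.sin φ)) / R)
      (-(a * -Real.sin φ + b * Real.cos φ) / R) φ :=
    ((((Real.hasDerivAt_cos φ).const_mul a).add
      ((Real.hasDerivAt_sin φ).const_mul b)).const_sub r).div_const R
  have h2 := (Real.hasDerivAt_arccos hlt.1.ne' hlt.2.ne).comp φ h1
  rw [← Real.sin_arccos] at h2
  refine h2.congr_deriv ?_
  have := (H.sin_halfArc_pos φ).ne'
  have hR := H.radius_pos.ne'
  change -(1 / Real.sin (halfArc a b R r φ)) * _ = _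
  field_simp
  ring

theorem tangentLength_pos (H : IsNestedRadii a b R r) (θ : ℝ) : 0 < tangentLength a b R r θ := by
  refine Real.sqrt_pos.2 ?_
  have h3 := (abs_le.1 (abs_dot_le_sqrt a b θ)).1
  have h4 : √(a ^ 2 + b ^ 2) ^ 2 = a ^ 2 + b ^ 2 := Real.sq_sqrt (by positivity)
  have h5 := pow_lt_pow_left₀ (show r < R - √(a ^ 2 + b ^ 2) by linarith [H.lt]) H.pos.le
    two_ne_zero
  have h6 : (a + R * Real.cos θ) ^ 2 + (b + R * Real.sin θ) ^ 2 =
      √(a ^ 2 + b ^ 2) ^ 2 + 2 * R * (a * Real.cos θ + b * Real.sin θ) + R ^ 2 := by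
    rw [h4]
    linear_combination R ^ 2 * Real.sin_sq_add_cos_sq θ
  rw [h6]
  nlinarith [mul_le_mul_of_nonneg_left h3 H.radius_pos.le]

/-- The integral of the inverse tangent length is a coordinate on the outer circle in which the
Poncelet map is a translation. -/
theorem exists_conjugation (H : IsNestedRadii a b R r) : ∃ G : ℝ → ℝ, StrictMono G ∧
    (∃ ω, ∀ θ, G (θ + 2 * Real.pi) = G θ + ω) ∧
    ∃ c, ∀ φ, G (φ + halfArc a b R r φ) = G (φ - halfArc a b R r φ) + c := by
  have hcont : Continuous fun θ => (tangentLength a b R r θ)⁻¹ := by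
    refine Continuous.inv₀ ?_ fun θ => (H.tangentLength_pos θ).ne'
    unfold tangentLength
    fun_prop
  set G : ℝ → ℝ := fun θ => ∫ t in (0 : ℝ)..θ, (tangentLength a b R r t)⁻¹ with hGdef
  have hG : ∀ θ, HasDerivAt G (tangentLength a b R r θ)⁻¹ θ := fun θ =>
    (hcont.integral_hasStrictDerivAt 0 θ).hasDerivAt
  refine ⟨G, strictMono_of_hasDerivAt_pos hG fun θ => inv_pos.2 (H.tangentLength_pos θ),
    ⟨∫ t in (0 : ℝ)..(0 + 2 * Real.pi), (tangentLength a b R r t)⁻¹, fun θ => ?_⟩, ?_⟩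
  · have hper : Function.Periodic (fun θ => (tangentLength a b R r θ)⁻¹) (2 * Real.pi) :=
      fun θ => by simp [tangentLength]
    rw [hper.intervalIntegral_add_eq 0 θ]
    exact (intervalIntegral.integral_add_adjacent_intervals (hcont.intervalIntegrable _ _)
      (hcont.intervalIntegrable _ _)).symm
  · have hd : ∀ φ, HasDerivAt
        (fun φ => G (φ + halfArc a b R r φ) - G (φ - halfArc a b R r φ)) 0 φ := by
      -- The two terms are $(1+v/u)/(u+v)$ and $(1-v/u)/(u-v)$, both equal to $1/u$.
      intro φ
      have h1 := (hG _).comp φ ((hasDerivAt_id φ).add (H.hasDerivAt_halfArc φ))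
      have h2 := (hG _).comp φ ((hasDerivAt_id φ).sub (H.hasDerivAt_halfArc φ))
      refine (h1.sub h2).congr_deriv ?_
      have hlt := abs_lt.1 (H.abs_lt_halfChord φ)
      have hpos := mul_pos H.radius_pos (H.sin_halfArc_pos φ)
      change (tangentLength a b R r (φ + halfArc a b R r φ))⁻¹ * _ -
        (tangentLength a b R r (φ - halfArc a b R r φ))⁻¹ * _ = 0
      rw [H.tangentLength_add, H.tangentLength_sub]
      generalize R * Real.sin (halfArc a b R r φ) = u at *
      generalize b * Real.cos φ - a * Real.sin φ = v at *
      have n1 : u + v ≠ 0 := by linarith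
      have n2 : u - v ≠ 0 := by linarith
      field_simp
      ring
    refine ⟨G (0 + halfArc a b R r 0) - G (0 - halfArc a b R r 0), fun φ => ?_⟩
    have := is_const_of_deriv_eq_zero (fun φ => (hd φ).differentiableAt) (fun φ => (hd φ).deriv) φ 0
    linarith

theorem surjective_sub_halfArc (H : IsNestedRadii a b R r) :
    Function.Surjective fun φ => φ - halfArc a b R r φ := by
  have hc : Continuous fun φ => φ - halfArc a b R r φ := continuous_id.sub
    (continuous_iff_continuousAt.2 fun φ => (H.hasDerivAt_halfArc φ).continuousAt)
  refine hc.surjective ?_ ?_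
  · exact tendsto_atTop_mono (fun φ => sub_le_sub_left (H.halfArc_mem φ).2.le φ)
      (tendsto_atTop_add_const_right _ (-Real.pi) tendsto_id)
  · exact tendsto_atBot_mono (fun φ => sub_le_self φ (H.halfArc_mem φ).1.le) tendsto_id

end IsNestedRadii

/-- Poncelet's closure theorem for two nested circles. -/
theorem hasPonceletClosure_sphere {C o : Plane} {R r : ℝ} (hr : 0 < r)
    (hsub : Metric.closedBall o r ⊆ Metric.ball C R) :
    HasPonceletClosure (Metric.sphere C R) (Metric.sphere o r) := by
  obtain ⟨p, x₀, hp, hpx⟩ := exists_eq_smul_turnVec (o - C)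
  have hnorm : ‖o - C‖ = p := by
    rw [hpx, norm_smul, norm_turnVec, Real.norm_of_nonneg hp, mul_one]
  have H : IsNestedRadii (C 0 - o 0) (C 1 - o 1) R r := by
    refine ⟨hr, ?_⟩
    have h1 : √((C 0 - o 0) ^ 2 + (C 1 - o 1) ^ 2) = p := by
      rw [← hnorm, EuclideanSpace.norm_eq, Fin.sum_univ_two]
      simp [sq_abs, sub_sq_comm]
    -- The point of the inner disc farthest from `C`; its distance from `C` is the sum of the
    -- central distance and `r`.
    have h2 : o + r • turnVec x₀ ∈ Metric.ball C R := hsub (by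
      simp [norm_smul, norm_turnVec, abs_of_pos hr])
    rw [mem_ball_iff_norm, add_sub_right_comm, hpx, ← add_smul, norm_smul, norm_turnVec,
      Real.norm_of_nonneg (by positivity), mul_one] at h2
    rwa [h1]
  have hR := H.radius_pos
  have h := isConvexParam_circle C hR
  set γ : ℝ → Plane := fun x => C + R • turnVec x with hγ
  have hfr : frontier (Metric.closedBall C R) = Metric.sphere C R := frontier_closedBall C hR.ne'
  have hLc : IsCompact (Metric.sphere o r) := isCompact_sphere o r
  have hLB : Metric.sphere o r ⊆ interior (Metric.closedBall C R) :=
    (Metric.sphere_subset_closedBall.trans hsub).trans Metric.ball_subset_interior_closedBall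
  have hne : (Metric.sphere o r).Nonempty := NormedSpace.sphere_nonempty.2 hr.le
  set T := ponceletLift γ (Metric.sphere o r) with hT
  have hπ := Real.pi_pos
  have hstep : ∀ φ, T ((φ - halfArc (C 0 - o 0) (C 1 - o 1) R r φ) / (2 * Real.pi)) =
      (φ + halfArc (C 0 - o 0) (C 1 - o 1) R r φ) / (2 * Real.pi) := by
    intro φ
    have hα := H.halfArc_mem φ
    have hc := H.cos_halfArc φ
    have hsin := H.sin_halfArc_pos φ
    set α := halfArc (C 0 - o 0) (C 1 - o 1) R r φ
    have hmem : (φ + α) / (2 * Real.pi) ∈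
        Ioo ((φ - α) / (2 * Real.pi)) ((φ - α) / (2 * Real.pi) + 1) := by
      constructor
      · rw [div_lt_div_iff_of_pos_right (by positivity)]; linarith [hα.1]
      · rw [div_add_one (by positivity), div_lt_div_iff_of_pos_right (by positivity)]
        linarith [hα.2]
    have h2π : ∀ y, 2 * Real.pi * (y / (2 * Real.pi)) = y := fun y => by field_simp
    have ho : ∀ X : Plane, orient (γ ((φ - α) / (2 * Real.pi))) (γ ((φ + α) / (2 * Real.pi))) X =
        2 * (R * Real.sin α) *
          (r - ((X 0 - o 0) * Real.cos φ + (X 1 - o 1) * Real.sin φ)) := by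
      intro X
      simp only [orient, hγ, PiLp.add_apply, PiLp.smul_apply, smul_eq_mul, turnVec_zero,
        turnVec_one, h2π, Real.cos_add, Real.cos_sub, Real.sin_add, Real.sin_sub]
      linear_combination 2 * R * Real.sin α * hc +
        2 * R ^ 2 * Real.sin α * Real.cos α * Real.sin_sq_add_cos_sq φ
    refine ((h.ponceletStep_iff hLc hLB hne hmem).1 ?_).symm
    refine ⟨h.mem_frontier _, h.mem_frontier _, h.ne_of_mem_Ioo hmem, fun X hX => ?_,
      o + r • turnVec (φ / (2 * Real.pi)), ?_, ?_⟩
    · rw [ho]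
      have hX' : (X 0 - o 0) ^ 2 + (X 1 - o 1) ^ 2 = r ^ 2 := by
        rw [mem_sphere_iff_norm, EuclideanSpace.norm_eq,
          Real.sqrt_eq_iff_mul_self_eq_of_pos hr, Fin.sum_univ_two] at hX
        simpa [sq_abs, ← sq] using hX.symm
      refine mul_nonneg (by positivity) (sub_nonneg.2 ?_)
      refine le_of_abs_le (abs_le_of_sq_le_sq ?_ hr.le)
      nlinarith [sq_nonneg ((X 0 - o 0) * Real.sin φ - (X 1 - o 1) * Real.cos φ),
        Real.sin_sq_add_cos_sq φ]
    · simp [norm_smul, norm_turnVec, abs_of_pos hr]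
    · rw [ho]
      simp only [PiLp.add_apply, PiLp.smul_apply, smul_eq_mul, turnVec_zero, turnVec_one, h2π]
      linear_combination (-2 * (R * Real.sin α) * r) * Real.sin_sq_add_cos_sq φ
  obtain ⟨G, hG, ⟨ω, hω⟩, c, hc⟩ := H.exists_conjugation
  have hGT : ∀ x, G (2 * Real.pi * T x) = G (2 * Real.pi * x) + c := by
    intro x
    obtain ⟨φ, hφ⟩ := H.surjective_sub_halfArc (2 * Real.pi * x)
    have hx : x = (φ - halfArc (C 0 - o 0) (C 1 - o 1) R r φ) / (2 * Real.pi) := by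
      rw [eq_div_iff (by positivity), mul_comm]; exact hφ.symm
    rw [← hφ, ← hc, hx, hstep]
    congr 1
    field_simp
  have hGn : ∀ (k : ℕ) x, G (2 * Real.pi * T^[k] x) = G (2 * Real.pi * x) + k * c := by
    intro k x
    induction k with
    | zero => simp
    | succ k ih => rw [Function.iterate_succ_apply', hGT, ih]; push_cast; ring
  have hGm : ∀ (m : ℤ) x, G (2 * Real.pi * (x + m)) = G (2 * Real.pi * x) + m * ω := by
    intro m x
    induction m using Int.induction_on with
    | zero => simp
    | succ k ih =>
      have := hω (2 * Real.pi * (x + (k : ℤ)))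
      rw [ih] at this
      push_cast at this ⊢
      rw [show 2 * Real.pi * (x + (k + 1)) = 2 * Real.pi * (x + k) + 2 * Real.pi by ring, this]
      ring
    | pred k ih =>
      have := hω (2 * Real.pi * (x + ((-k - 1 : ℤ) : ℝ)))
      rw [show 2 * Real.pi * (x + ((-k - 1 : ℤ) : ℝ)) + 2 * Real.pi =
        2 * Real.pi * (x + ((-k : ℤ) : ℝ)) by push_cast; ring, ih] at this
      push_cast at this ⊢
      linarith
  -- The criterion on the right is free of `x`, which is the closure property.
  have hiff : ∀ (k : ℕ) (x : ℝ) (m : ℤ), T^[k] x = x + m ↔ k * c = m * ω := by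
    intro k x m
    rw [← mul_right_inj' (show 2 * Real.pi ≠ 0 by positivity), ← hG.injective.eq_iff, hGn, hGm,
      add_right_inj]
  intro n hn hpair A hA
  rw [← hfr] at hpair hA ⊢
  obtain ⟨x, hx⟩ := h.isPonceletPair_iff.1 hpair
  obtain ⟨y, rfl⟩ := h.range_eq ▸ hA
  rw [h.ponceletCloses_iff hLc hLB hne] at hx ⊢
  simpa only [← hT, hiff] using hx

/-! ### Discs as convex bodies and nested families of discs. -/

theorem pos_of_interior_closedBall_nonempty {c : Plane} {r : ℝ}
    (h : (interior (Metric.closedBall c r)).Nonempty) : 0 < r := by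
  by_contra! hr
  rcases hr.lt_or_eq with hr | rfl
  · simp [Metric.closedBall_eq_empty.2 hr] at h
  · simp at h

theorem isDifferentiableConvexBody_closedBall (c : Plane) {r : ℝ} (hr : 0 < r) :
    IsDifferentiableConvexBody (Metric.closedBall c r) where
  compact := isCompact_closedBall c r
  convex := convex_closedBall c r
  interior_nonempty :=
    ⟨c, Metric.ball_subset_interior_closedBall (Metric.mem_ball_self hr)⟩
  unique_normal := by
    intro P hP
    rw [frontier_closedBall c hr.ne', mem_sphere_iff_norm] at hP
    have hn : ‖c - P‖ = r := by rw [norm_sub_rev, hP]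
    refine ⟨r⁻¹ • (c - P), ⟨?_, fun X hX => ?_⟩, fun u ⟨hu, hX⟩ => ?_⟩
    · rw [norm_smul, hn, Real.norm_of_nonneg (inv_nonneg.2 hr.le), inv_mul_cancel₀ hr.ne']
    · rw [real_inner_smul_left]
      refine mul_nonneg (inv_nonneg.2 hr.le) ?_
      have h1 : X - P = (c - P) + (X - c) := by abel
      have h2 := (abs_le.1 (abs_real_inner_le_norm (c - P) (X - c))).1
      rw [mem_closedBall_iff_norm] at hX
      rw [h1, inner_add_right, real_inner_self_eq_norm_sq]
      rw [hn] at h2 ⊢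
      nlinarith
    -- The point of the disc extreme in direction `-u` turns the supporting inequality into equality
    -- in Cauchy–Schwarz.
    · have h1 := hX (c - r • u) (by simp [norm_smul, hu, abs_of_pos hr])
      rw [show c - r • u - P = (c - P) - r • u by abel, inner_sub_right, real_inner_smul_right,
        real_inner_self_eq_norm_sq, hu, one_pow, mul_one, sub_nonneg] at h1
      have h2 : inner ℝ u (c - P) = ‖u‖ * ‖c - P‖ :=
        le_antisymm (real_inner_le_norm _ _) (by rw [hu, hn, one_mul]; exact h1)
      rw [inner_eq_norm_mul_iff_real, hu, hn, one_smul] at h2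
      rw [← h2, inv_smul_smul₀ hr.ne']

theorem hausdorffDist_closedBall_le (c : Plane) {p q : ℝ} (hp : 0 ≤ p) (hq : 0 ≤ q) :
    Metric.hausdorffDist (Metric.closedBall c p) (Metric.closedBall c q) ≤ |p - q| := by
  have key : ∀ p q : ℝ, 0 ≤ p → 0 ≤ q → ∀ X ∈ Metric.closedBall c p,
      ∃ Y ∈ Metric.closedBall c q, dist X Y ≤ |p - q| := by
    intro p q hp hq X hX
    obtain ⟨s, x, hs, hsx⟩ := exists_eq_smul_turnVec (X - c)
    have hsp : s ≤ p := by
      rw [mem_closedBall_iff_norm, hsx, norm_smul, norm_turnVec, Real.norm_of_nonneg hs] at hX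
      linarith
    have hX' : X = c + s • turnVec x := by rw [← hsx]; abel
    refine ⟨c + min s q • turnVec x, ?_, ?_⟩
    · rw [mem_closedBall_iff_norm, add_sub_cancel_left, norm_smul, norm_turnVec,
        Real.norm_of_nonneg (le_min hs hq), mul_one]
      exact min_le_right _ _
    · rw [hX', dist_eq_norm, add_sub_add_left_eq_sub, ← sub_smul, norm_smul, norm_turnVec, mul_one,
        Real.norm_of_nonneg (sub_nonneg.2 (min_le_left _ _))]
      rcases min_cases s q with h | h
      · rw [h.1, sub_self]; exact abs_nonneg _
      · rw [h.1]; exact (sub_le_sub_right hsp q).trans (le_abs_self _)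
  refine Metric.hausdorffDist_le_of_mem_dist (abs_nonneg _) (key p q hp hq) fun X hX => ?_
  rw [abs_sub_comm]
  exact key q p hq hp X hX

theorem isNestedFamily_concentric {C o : Plane} {R : ℝ} (h : dist o C < R) :
    IsNestedFamily (Metric.closedBall C R)
      fun t => Metric.closedBall o (t * (R - dist o C)) := by
  have hρ : 0 < R - dist o C := sub_pos.2 h
  have hR : 0 < R := dist_nonneg.trans_lt h
  have hsub : ∀ t ≤ 1, Metric.closedBall o (t * (R - dist o C)) ⊆ Metric.closedBall C R :=
    fun t ht => Metric.closedBall_subset_closedBall' (by nlinarith)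
  obtain ⟨p, x, hp, hpx⟩ := exists_eq_smul_turnVec (o - C)
  have hnorm : dist o C = p := by
    rw [dist_eq_norm, hpx, norm_smul, norm_turnVec, Real.norm_of_nonneg hp, mul_one]
  constructor
  · exact fun t ht => isDifferentiableConvexBody_closedBall o (mul_pos ht.1 hρ)
  · exact ⟨o, by simp⟩
  · intro s hs t ht hst
    have hlt : s * (R - dist o C) < t * (R - dist o C) := mul_lt_mul_of_pos_right hst hρ
    have ht0 : 0 ≤ t * (R - dist o C) := mul_nonneg ht.1 hρ.le
    refine ⟨Metric.closedBall_subset_closedBall hlt.le, fun hle => ?_⟩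
    have := hle (show o + (t * (R - dist o C)) • turnVec 0 ∈ _ by
      rw [mem_closedBall_iff_norm, add_sub_cancel_left, norm_smul, norm_turnVec,
        Real.norm_of_nonneg ht0, mul_one])
    rw [mem_closedBall_iff_norm, add_sub_cancel_left, norm_smul, norm_turnVec,
      Real.norm_of_nonneg ht0, mul_one] at this
    linarith
  · intro t ht
    have hlim : Tendsto (fun s => |s * (R - dist o C) - t * (R - dist o C)|)
        (𝓝[Icc 0 1] t) (𝓝 0) := by
      have hc : Continuous fun s : ℝ => |s * (R - dist o C) - t * (R - dist o C)| := by fun_prop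
      simpa using (hc.tendsto t).mono_left nhdsWithin_le_nhds
    refine squeeze_zero' (Eventually.of_forall fun _ => Metric.hausdorffDist_nonneg) ?_ hlim
    filter_upwards [self_mem_nhdsWithin] with s hs
    exact hausdorffDist_closedBall_le o (mul_nonneg hs.1 hρ.le) (mul_nonneg ht.1 hρ.le)
  · intro t ht
    rw [interior_closedBall C hR.ne']
    intro X hX
    rw [Metric.mem_ball]
    rw [Metric.mem_closedBall] at hX
    nlinarith [dist_triangle X o C, ht.2]
  · exact hsub 1 le_rfl
  -- The touching point lies on the ray from `C` through `o`; for `o = C` any direction serves.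
  · refine ⟨o + (R - dist o C) • turnVec x, ?_, ?_⟩
    · rw [one_mul, mem_closedBall_iff_norm, add_sub_cancel_left, norm_smul, norm_turnVec,
        Real.norm_of_nonneg hρ.le, mul_one]
    · rw [frontier_closedBall C hR.ne', mem_sphere_iff_norm, add_sub_right_comm, hpx, ← add_smul,
        hnorm, norm_smul, norm_turnVec, add_sub_cancel, Real.norm_of_nonneg hR.le, mul_one]

theorem hasHalfTotientMany_of_circles {n : ℕ} (hn : 3 ≤ n) {C : Plane} {R : ℝ} {o : ℝ → Plane}
    {ρ : ℝ → ℝ}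
    (hD : IsNestedFamily (Metric.closedBall C R) fun t => Metric.closedBall (o t) (ρ t)) :
    HasHalfTotientMany n {L | ∃ t ∈ Ioo (0 : ℝ) 1,
      L = Metric.sphere (o t) (ρ t) ∧ IsPonceletPair n (Metric.sphere C R) L} := by
  have hρ : ∀ t ∈ Ioc (0 : ℝ) 1, 0 < ρ t := fun t ht =>
    pos_of_interior_closedBall_nonempty (hD.body t ht).interior_nonempty
  have hBi : (interior (Metric.closedBall C R)).Nonempty :=
    (hD.body 1 (by simp)).interior_nonempty.mono (interior_mono hD.subset_one)
  have hR := pos_of_interior_closedBall_nonempty hBi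
  have hfr : ∀ t ∈ Ioo (0 : ℝ) 1,
      frontier (Metric.closedBall (o t) (ρ t)) = Metric.sphere (o t) (ρ t) := fun t ht =>
    frontier_closedBall _ (hρ t ⟨ht.1, ht.2.le⟩).ne'
  have key := hD.hasHalfTotientMany (isConvexParam_circle C hR)
    (strictConvex_closedBall ℝ C R) hBi (fun t ht => by
      rw [hfr t ht, frontier_closedBall C hR.ne']
      refine hasPonceletClosure_sphere (hρ t ⟨ht.1, ht.2.le⟩) ?_
      rw [← interior_closedBall C hR.ne']
      exact hD.inside t ⟨ht.1.le, ht.2⟩) hn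
  rw [frontier_closedBall C hR.ne'] at key
  convert key using 2
  ext L
  exact exists_congr fun t => and_congr_right fun ht => by rw [hfr t ht]

/-- Counting `n`-Poncelet pairs, for a fixed circle and the circles inside it with a given centre,
for a fixed circle and any nested family of circles, and for a nested family of convex curves whose
members have the closure property with respect to the fixed strictly convex curve. -/
theorem theorem1 (n : ℕ) (hn : 3 ≤ n) :
    (∀ (C o : Plane) (R : ℝ), dist o C < R →
      HasHalfTotientMany n {L | ∃ t ∈ Set.Ioo 0 (R - dist o C),
        L = Metric.sphere o t ∧ IsPonceletPair n (Metric.sphere C R) L}) ∧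
    (∀ (C : Plane) (R : ℝ) (o : ℝ → Plane) (ρ : ℝ → ℝ),
      IsNestedFamily (Metric.closedBall C R) (fun t => Metric.closedBall (o t) (ρ t)) →
      HasHalfTotientMany n {L | ∃ t ∈ Set.Ioo (0 : ℝ) 1,
        L = Metric.sphere (o t) (ρ t) ∧ IsPonceletPair n (Metric.sphere C R) L}) ∧
    (∀ (B : Set Plane) (D : ℝ → Set Plane),
      IsDifferentiableConvexBody B → StrictConvex ℝ B → IsNestedFamily B D →
      (∀ t ∈ Set.Ioo (0 : ℝ) 1, HasPonceletClosure (frontier B) (frontier (D t))) →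
      HasHalfTotientMany n {L | ∃ t ∈ Set.Ioo (0 : ℝ) 1,
        L = frontier (D t) ∧ IsPonceletPair n (frontier B) L}) := by
  refine ⟨fun C o R h => ?_, fun C R o ρ hD => hasHalfTotientMany_of_circles hn hD,
    fun B D hB hBc hD hcl => ?_⟩
  · have hρ : 0 < R - dist o C := sub_pos.2 h
    convert hasHalfTotientMany_of_circles hn (isNestedFamily_concentric h) using 2
    ext L
    constructor
    · rintro ⟨t, ht, rfl, hp⟩
      exact ⟨t / (R - dist o C), ⟨div_pos ht.1 hρ, (div_lt_one hρ).2 ht.2⟩,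
        by rw [div_mul_cancel₀ _ hρ.ne'], hp⟩
    · rintro ⟨t, ht, rfl, hp⟩
      exact ⟨t * (R - dist o C), ⟨mul_pos ht.1 hρ, by nlinarith [ht.2]⟩, rfl, hp⟩
  · obtain ⟨o, ho⟩ := hB.interior_nonempty
    exact hD.hasHalfTotientMany (isConvexParam_polarParam hB.compact hBc ho) hBc
      ⟨o, ho⟩ hcl hn
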